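/- Let $G$ be a finite simple graph with an edge-coloring (adjacent edges may receive the same color). A tree in $G$ is a rainbow tree if no two of its edges have the same color. The $3$-rainbow index $rx_3(G)$ of a connected graph $G$ is the minimum number of colors in an edge-coloring of $G$ such that for every set $S$ of three vertices there is a rainbow tree in $G$ containing all vertices of $S$. Theorem. Let $G$ be a $2$-edge-connected graph of order $n\ge 4$. Then $rx_3(G)\le n-2$. Moreover $rx_3(G)=n-2$ if and only if one of the following holds: (a) $G$ is $2$-connected, and $G$ is the cycle $C_n$, or a spanning subgraph of the $3$-sun (the cycle $v_1v_2v_3v_4v_5v_6v_1$ together with the edges $v_2v_4$, $v_2v_6$, $v_4v_6$), or a spanning subgraph of $K_5-e$ ($K_5$ with one edge deleted), or a spanning subgraph of $K_4$; (b) $G$ is isomorphic to one of the following five graphs: $F_1$, two triangles sharing exactly one vertex (order $5$); $F_2$, a $4$-cycle $v_1v_2v_3v_4v_1$ and a triangle $v_4v_5v_6$ sharing exactly the vertex $v_4$ (order $6$); $F_3=F_2+v_1v_3$; $F_4=F_2+v_2v_4$; and $F_5$, the chain of three triangles $v_1v_2v_3$, $v_3v_4v_5$, $v_5v_6v_7$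 on seven distinct vertices. -/

import Mathlib

namespace RainbowIndex

open SimpleGraph

/-- A subgraph `T` of `G` is a rainbow tree for the edge-coloring `c` if it is a tree and no two
of its edges receive the same color. -/
def IsRainbowTree {V K : Type*} {G : SimpleGraph V} (c : G.EdgeLabeling K) (T : G.Subgraph) :
    Prop :=
  T.coe.IsTree ∧
    ∀ e f : G.edgeSet, (e : Sym2 V) ∈ T.edgeSet → (f : Sym2 V) ∈ T.edgeSet → c e = c f → e = f

/-- `c` is a `k`-rainbow coloring if every `k`-subset `S` of the vertices has a rainbow `S`-tree,
that is, a rainbow tree that contains all vertices of `S`. -/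
def IsRainbowColoring {V K : Type*} {G : SimpleGraph V} (k : ℕ) (c : G.EdgeLabeling K) : Prop :=
  ∀ S : Finset V, S.card = k → ∃ T : G.Subgraph, IsRainbowTree c T ∧ (S : Set V) ⊆ T.verts

/-- The `k`-rainbow index `rx_k(G)`: the least number `q` of colors for which `G` has a `k`-rainbow
coloring with colors in a set of size `q`. -/
noncomputable def rx {V : Type*} (k : ℕ) (G : SimpleGraph V) : ℕ :=
  sInf {q : ℕ | ∃ c : G.EdgeLabeling (Fin q), IsRainbowColoring k c}

/-- On a finite connected graph the set in the definition of `rx` is nonempty, so `rx k G` is an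
attained minimum. -/
theorem exists_isRainbowColoring_rx {V : Type*} [Finite V] (k : ℕ) (G : SimpleGraph V)
    (hG : G.Connected) : ∃ c : G.EdgeLabeling (Fin (rx k G)), IsRainbowColoring k c := by
  refine Nat.sInf_mem (s := {q : ℕ | ∃ c : G.EdgeLabeling (Fin q), IsRainbowColoring k c}) ?_
  obtain ⟨H, hH, hT⟩ := hG.exists_isTree_le
  obtain ⟨q, ⟨φ⟩⟩ := Finite.exists_equiv_fin G.edgeSet
  refine ⟨q, (fun e => φ e), fun S _ => ⟨toSubgraph H hH, ⟨?_, fun e f _ _ h => φ.injective h⟩, ?_⟩⟩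
  · have e : H ≃g (toSubgraph H hH).coe :=
      { toEquiv := (Equiv.Set.univ V).symm
        map_rel_iff' := Iff.rfl }
    exact e.isTree_iff.1 hT
  · exact fun x _ => Set.mem_univ x

/-- A graph is 2-connected if it has at least three vertices, is connected, and stays connected
when any one vertex is deleted. -/
def IsTwoConnected {V : Type*} (G : SimpleGraph V) : Prop :=
  3 ≤ Nat.card V ∧ G.Connected ∧ ∀ v : V, (G.induce {v}ᶜ).Connected

/-- `G` is (isomorphic to) a spanning subgraph of `H`. -/
def IsSpanningSubgraphOf {V W : Type*} (G : SimpleGraph V) (H : SimpleGraph W) : Prop :=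
  ∃ f : V ≃ W, ∀ u v : V, G.Adj u v → H.Adj (f u) (f v)

/-- The graph on `Fin n` whose edges are the (non-loop) pairs in the given list. -/
def ofEdges {n : ℕ} (l : List (Sym2 (Fin n))) : SimpleGraph (Fin n) :=
  fromEdgeSet {e | e ∈ l}

/-- The 3-sun: the cycle `0 1 2 3 4 5` together with the triangle `1 3 5`. -/
def threeSun : SimpleGraph (Fin 6) :=
  ofEdges [s(0, 1), s(1, 2), s(2, 3), s(3, 4), s(4, 5), s(5, 0), s(1, 3), s(1, 5), s(3, 5)]

/-- The complete graph on five vertices minus an edge. -/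
def K5MinusEdge : SimpleGraph (Fin 5) :=
  (⊤ : SimpleGraph (Fin 5)).deleteEdges {s(0, 1)}

/-- Two triangles with a common vertex. -/
def F1 : SimpleGraph (Fin 5) :=
  ofEdges [s(0, 1), s(1, 2), s(2, 0), s(2, 3), s(3, 4), s(4, 2)]

/-- A 4-cycle `0 1 2 3` and a triangle `3 4 5` with the common vertex `3`. -/
def F2 : SimpleGraph (Fin 6) :=
  ofEdges [s(0, 1), s(1, 2), s(2, 3), s(3, 0), s(3, 4), s(4, 5), s(5, 3)]

/-- `F2` together with the chord of the 4-cycle that avoids the common vertex `3`. -/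
def F3 : SimpleGraph (Fin 6) :=
  ofEdges [s(0, 1), s(1, 2), s(2, 3), s(3, 0), s(3, 4), s(4, 5), s(5, 3), s(0, 2)]

/-- `F2` together with the chord of the 4-cycle at the common vertex `3`. -/
def F4 : SimpleGraph (Fin 6) :=
  ofEdges [s(0, 1), s(1, 2), s(2, 3), s(3, 0), s(3, 4), s(4, 5), s(5, 3), s(1, 3)]

/-- A chain of three triangles `0 1 2`, `2 3 4`, `4 5 6`: the first two share the vertex `2`, the
last two share the vertex `4`. -/
def F5 : SimpleGraph (Fin 7) :=
  ofEdges [s(0, 1), s(1, 2), s(2, 0), s(2, 3), s(3, 4), s(4, 2), s(4, 5), s(5, 6), s(6, 4)]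

/-- The 2-connected extremal graphs: `G` is 2-connected and it is a cycle or a spanning subgraph
of the 3-sun, of `K₅` minus an edge, or of `K₄`. -/
def IsTwoConnectedExtremal {V : Type*} (G : SimpleGraph V) : Prop :=
  IsTwoConnected G ∧
    (Nonempty (G ≃g cycleGraph (Nat.card V)) ∨ IsSpanningSubgraphOf G threeSun ∨
      IsSpanningSubgraphOf G K5MinusEdge ∨ IsSpanningSubgraphOf G (completeGraph (Fin 4)))

/-- The five further extremal graphs, each with a cut vertex. -/
def IsCutVertexExtremal {V : Type*} (G : SimpleGraph V) : Prop :=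
  Nonempty (G ≃g F1) ∨ Nonempty (G ≃g F2) ∨ Nonempty (G ≃g F3) ∨ Nonempty (G ≃g F4) ∨
    Nonempty (G ≃g F5)

end RainbowIndex

/-!
Colours are saved with respect to the number `n` of vertices by contracting `G`. Suppose that the
vertex set of a connected graph `G` is partitioned into connected classes and that the contracted
graph contains a spanning *pattern*: a graph with `k` vertices, coloured with `q` colours, in which
any three vertices lie in a rainbow tree. Span each class by a tree whose `n - k` edges (over all
classes) get private colours, and give the edges between the classes the colours of the pattern. A
rainbow tree of the pattern together with the spanning trees of the classes then is a rainbow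
connected set of edges, so `rx 3 G ≤ n - k + q` (`Pattern.IsValid.rx_le`). Disjoint connected branch
sets always grow to such a partition (`exists_labelling`), so that it is enough to find the pattern
as a minor. Nineteen patterns are used. The 4-cycle and two triangles with a common vertex have
`k - q = 2`, the others have `k - q = 3`.

*Upper bound.* A 2-edge-connected graph with at least four vertices has a cycle of length at least
four or two triangles with a common vertex, hence `rx 3 G ≤ n - 2` (`rx_add_two_le`).

*Equality forces an extremal graph.* If `rx 3 G = n - 2`, then no pattern with `k - q = 3` is a minor
of `G`. Let `l` be a longest cycle. As `G` is 2-edge-connected, every proper nonempty set of vertices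
has an ear, possibly a closed one (`exists_isEar`).
* If `l` has length at least five, then an ear of `l` yields a pattern, so `l` is Hamiltonian, and
  patterns also arise from most chords. What remains are cycles, spanning subgraphs of the 3-sun and
  spanning subgraphs of `K₅` minus an edge (`isTwoConnectedExtremal_of_five_le`).
* If `l` has length four and misses a vertex, then an ear extends `l` to a `K_{2,3}` or to a 4-cycle
  with a triangle, and every further ear yields a pattern (`extremal_of_eq_four`).
* If all cycles are triangles, then `G` grows from a triangle by attaching triangles at single
  vertices, and the patterns leave only `F1` and `F5` (`isCutVertexExtremal_of_bowtie`).

*The extremal graphs need `n - 2` colours.* The edges of a rainbow tree through three vertices are at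
most as many as the colours, and they meet every cut that separates these vertices
(`IsRainbowColoring.exists_edges`). For each of the graphs of bounded order this leaves few trees for
suitable triples of vertices, and their colour conditions contradict each other. On a cycle with `n`
edges and `n - 3` colours there are at most six edges among which a colour is repeated even after two
of them are deleted (`exists_repeated_color`). Three vertices cut the cycle into arcs with at most
two of these edges each (`exists_three_arcs`). A tree through these vertices contains all edges
outside one of the arcs, so it is not rainbow (`card_le_rx_of_cycle`).
-/

namespace RainbowIndex

open SimpleGraph

variable {V : Type*} {G : SimpleGraph V}

/-! ### Rainbow trees from rainbow edge sets -/

/-- A rainbow set of edges contains a rainbow tree that spans the component of `x`. -/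
theorem exists_isRainbowTree {V K : Type*} {G : SimpleGraph V} (c : G.EdgeLabeling K)
    (F : Set (Sym2 V)) (hF : F ⊆ G.edgeSet)
    (hc : ∀ e f : G.edgeSet, (e : Sym2 V) ∈ F → (f : Sym2 V) ∈ F → c e = c f → e = f) (x : V) :
    ∃ T : G.Subgraph, IsRainbowTree c T ∧ ∀ y, (fromEdgeSet F).Reachable x y → y ∈ T.verts := by
  set H := fromEdgeSet F
  let C := H.connectedComponentMk x
  have hconn : (H.induce C.supp).Connected := C.maximal_connected_induce_supp.prop
  obtain ⟨T₀, hT₀, htree⟩ := hconn.exists_isTree_le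
  have hadj : ∀ u v : C.supp, T₀.Adj u v → s((u : V), (v : V)) ∈ F := fun u v h => by
    have := hT₀ h
    simp only [comap_adj, Function.Embedding.subtype_apply, H, fromEdgeSet_adj] at this
    exact this.1
  let T : G.Subgraph :=
    { verts := C.supp
      Adj := fun u v => ∃ (hu : u ∈ C.supp) (hv : v ∈ C.supp), T₀.Adj ⟨u, hu⟩ ⟨v, hv⟩
      adj_sub := by
        rintro u v ⟨hu, hv, h⟩
        exact hF (hadj _ _ h)
      edge_vert := by
        rintro u v ⟨hu, hv, h⟩
        exact hu
      symm := ⟨by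
        rintro u v ⟨hu, hv, h⟩
        exact ⟨hv, hu, h.symm⟩⟩ }
  refine ⟨T, ⟨?_, ?_⟩, ?_⟩
  · have : T.coe = T₀ := by
      ext u v
      exact ⟨fun ⟨_, _, h⟩ => h, fun h => ⟨u.2, v.2, h⟩⟩
    rw [this]
    exact htree
  · have hsub : ∀ e : Sym2 V, e ∈ T.edgeSet → e ∈ F := by
      intro e
      induction e with
      | _ u v =>
        rintro ⟨hu, hv, h⟩
        exact hadj _ _ h
    exact fun e f he hf h => hc e f (hsub _ he) (hsub _ hf) h
  · intro y hy
    change H.connectedComponentMk y = H.connectedComponentMk x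
    exact ConnectedComponent.eq.2 hy.symm

theorem rx_le_of_rainbow_reachable {V : Type*} {G : SimpleGraph V} {N : ℕ} (c : Sym2 V → ℕ)
    (hN : ∀ e, c e < N)
    (h : ∀ x y z : V, ∃ F ⊆ G.edgeSet, Set.InjOn c F ∧
      (fromEdgeSet F).Reachable x y ∧ (fromEdgeSet F).Reachable x z) : rx 3 G ≤ N := by
  classical
  refine Nat.sInf_le ⟨fun e => ⟨c e, hN e⟩, fun S hS => ?_⟩
  obtain ⟨x, y, z, -, -, -, rfl⟩ := Finset.card_eq_three.1 hS
  obtain ⟨F, hF, hinj, hy, hz⟩ := h x y z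
  obtain ⟨T, hT, hmem⟩ := exists_isRainbowTree (G := G) (fun e => (⟨c e, hN e⟩ : Fin N)) F hF
    (fun e f he hf hef => Subtype.ext (hinj he hf (by simpa using hef))) x
  refine ⟨T, hT, ?_⟩
  intro v hv
  simp only [Finset.coe_insert, Finset.coe_singleton, Set.mem_insert_iff,
    Set.mem_singleton_iff] at hv
  rcases hv with rfl | rfl | rfl
  exacts [hmem _ .rfl, hmem _ hy, hmem _ hz]

/-! ### Coloured patterns -/

/-- A graph on the vertices `0, …, order - 1` with an edge colouring, given by the list of the
triples `(u, v, colour)`, together with a list of rainbow trees. A tree is the list of the positions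
of its edges in `edges`, in an order in which `IsGrown` holds. -/
structure Pattern where
  order : ℕ
  colors : ℕ
  edges : List (ℕ × ℕ × ℕ)
  trees : List (List ℕ)

/-- The endpoints of the edges in a list. -/
def endpoints (t : List (ℕ × ℕ × ℕ)) : List ℕ := t.flatMap fun e => [e.1, e.2.1]

/-- Read from its end, the list adds edges one by one, each of them meeting an earlier one. -/
def IsGrown : List (ℕ × ℕ × ℕ) → Prop
  | [] => True
  | e :: t => (t = [] ∨ e.1 ∈ endpoints t ∨ e.2.1 ∈ endpoints t) ∧ IsGrown t

instance decidableIsGrown : DecidablePred IsGrown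
  | [] => inferInstanceAs (Decidable True)
  | e :: t =>
    have := decidableIsGrown t
    inferInstanceAs (Decidable ((t = [] ∨ e.1 ∈ endpoints t ∨ e.2.1 ∈ endpoints t) ∧ IsGrown t))

theorem IsGrown.rel_of_mem_endpoints {R : ℕ → ℕ → Prop} (hR : Equivalence R) :
    ∀ {t : List (ℕ × ℕ × ℕ)}, IsGrown t → (∀ e ∈ t, R e.1 e.2.1) →
      ∀ x ∈ endpoints t, ∀ y ∈ endpoints t, R x y
  | [], _, _, x, hx, _, _ => by simp [endpoints] at hx
  | e :: t, ⟨h1, h2⟩, h, x, hx, y, hy => by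
    have ih := h2.rel_of_mem_endpoints hR (fun e he => h e (List.mem_cons_of_mem _ he))
    have he := h e List.mem_cons_self
    have key : ∀ x ∈ endpoints (e :: t), R e.1 x := by
      intro x hx
      have hx' : x = e.1 ∨ x = e.2.1 ∨ x ∈ endpoints t := by
        simpa [endpoints, or_assoc] using hx
      rcases hx' with rfl | rfl | hx'
      · exact hR.refl _
      · exact he
      · rcases h1 with rfl | h1 | h1
        · simp [endpoints] at hx'
        · exact ih _ h1 _ hx'
        · exact hR.trans he (ih _ h1 _ hx')
    exact hR.trans (hR.symm (key x hx)) (key y hy)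

namespace Pattern

/-- The edges of the tree with the given edge positions. -/
def tree (P : Pattern) (t : List ℕ) : List (ℕ × ℕ × ℕ) := t.map fun i => P.edges.getD i (0, 0, 0)

/-- Every triple of vertices lies in one of the listed trees, which are rainbow. -/
def IsValid (P : Pattern) : Prop :=
  (∀ d ∈ P.edges, d.1 < d.2.1 ∧ d.2.1 < P.order ∧ d.2.2 < P.colors) ∧
  (∀ d ∈ P.edges, ∀ e ∈ P.edges, d.1 = e.1 → d.2.1 = e.2.1 → d = e) ∧
  (∀ t ∈ P.trees, (∀ d ∈ P.tree t, d ∈ P.edges) ∧ ((P.tree t).map fun d => d.2.2).Nodup ∧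
    IsGrown (P.tree t)) ∧
  ∀ x ∈ List.range P.order, ∀ y ∈ List.range P.order, ∀ z ∈ List.range P.order, ∃ t ∈ P.trees,
    x ∈ endpoints (P.tree t) ∧ y ∈ endpoints (P.tree t) ∧ z ∈ endpoints (P.tree t)

instance (P : Pattern) : Decidable P.IsValid := by
  unfold IsValid
  infer_instance

end Pattern

/-! ### Connected sets of vertices -/

theorem Connected.exists_adj_dist_lt {X : Type*} {H : SimpleGraph X} (hH : H.Connected) (r v : X)
    (hv : v ≠ r) : ∃ u, H.Adj v u ∧ H.dist u r < H.dist v r := by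
  obtain ⟨p, hp⟩ := hH.exists_walk_length_eq_dist v r
  cases p with
  | nil => exact absurd rfl hv
  | cons h q =>
    refine ⟨_, h, ?_⟩
    have := H.dist_le q
    simp only [Walk.length_cons] at hp
    omega

theorem exists_adj_of_mem_of_notMem {V : Type*} {G : SimpleGraph V} {S : Set V} {x y : V}
    (h : G.Reachable x y) (hx : x ∈ S) (hy : y ∉ S) : ∃ u ∈ S, ∃ v ∉ S, G.Adj u v := by
  obtain ⟨p⟩ := h
  obtain ⟨d, -, h1, h2⟩ := p.exists_boundary_dart S hx hy
  exact ⟨_, h1, _, h2, d.adj⟩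

theorem connected_induce_singleton {V : Type*} (G : SimpleGraph V) (v : V) :
    (G.induce {v}).Connected := by
  have : Nonempty ({v} : Set V) := ⟨⟨v, rfl⟩⟩
  exact ⟨fun a b => by rw [Subsingleton.elim a b]⟩

theorem connected_induce_insert {V : Type*} {G : SimpleGraph V} {S : Set V} {u v : V}
    (hS : (G.induce S).Connected) (hu : u ∈ S) (h : G.Adj v u) :
    (G.induce (insert v S)).Connected :=
  connected_induce_union (s := {v})
    (connected_induce_singleton G v).preconnected hS.preconnected rfl hu h

/-- Disjoint connected sets of vertices of a connected graph extend to a partition of the vertex set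
into connected sets. -/
theorem exists_labelling {V : Type*} [Finite V] {G : SimpleGraph V} (hG : G.Connected) {k : ℕ}
    (hk : 0 < k) (B : ℕ → Set V) (hB : ∀ i < k, (G.induce (B i)).Connected)
    (hd : ∀ i < k, ∀ j < k, i ≠ j → Disjoint (B i) (B j)) :
    ∃ f : V → ℕ, (∀ v, f v < k) ∧ (∀ i < k, ∀ v ∈ B i, f v = i) ∧
      ∀ i < k, (G.induce {v | f v = i}).Connected := by
  classical
  have := Fintype.ofFinite V
  -- `k` is the label of the vertices that are not in one of the sets yet
  suffices H : ∀ m : ℕ, ∀ f : V → ℕ, (∀ v, f v ≤ k) → (∀ i < k, ∀ v ∈ B i, f v = i) →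
      (∀ i < k, (G.induce {v | f v = i}).Connected) →
      (Finset.univ.filter fun v => f v = k).card = m →
      ∃ f : V → ℕ, (∀ v, f v < k) ∧ (∀ i < k, ∀ v ∈ B i, f v = i) ∧
        ∀ i < k, (G.induce {v | f v = i}).Connected by
    let f : V → ℕ := fun v => if h : ∃ i < k, v ∈ B i then h.choose else k
    have hf1 : ∀ i < k, ∀ v ∈ B i, f v = i := by
      intro i hi v hv
      have h : ∃ i < k, v ∈ B i := ⟨i, hi, hv⟩
      simp only [f, dif_pos h]
      by_contra hne
      exact Set.disjoint_left.1 (hd _ h.choose_spec.1 _ hi hne) h.choose_spec.2 hv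
    have hf2 : ∀ i < k, {v | f v = i} = B i := by
      intro i hi
      ext v
      refine ⟨fun hv => ?_, fun hv => hf1 i hi v hv⟩
      by_cases h : ∃ i < k, v ∈ B i
      · obtain ⟨j, hj, hvj⟩ := h
        have : f v = j := hf1 j hj v hvj
        have hv : f v = i := hv
        obtain rfl : j = i := this.symm.trans hv
        exact hvj
      · have hv : f v = i := hv
        simp only [f, dif_neg h] at hv
        omega
    refine H _ f (fun v => ?_) hf1 (fun i hi => ?_) rfl
    · by_cases h : ∃ i < k, v ∈ B i
      · obtain ⟨j, hj, hvj⟩ := h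
        rw [hf1 j hj v hvj]
        exact hj.le
      · simp only [f, dif_neg h, le_refl]
    · rw [hf2 i hi]
      exact hB i hi
  intro m
  induction m with
  | zero =>
    intro f h1 h2 h3 h4
    refine ⟨f, fun v => lt_of_le_of_ne (h1 v) fun h => ?_, h2, h3⟩
    rw [Finset.card_eq_zero] at h4
    have : v ∈ Finset.univ.filter fun v => f v = k := by simp [h]
    simp [h4] at this
  | succ m ih =>
    intro f h1 h2 h3 h4
    obtain ⟨y, hy⟩ : (Finset.univ.filter fun v => f v = k).Nonempty := by
      rw [← Finset.card_pos]
      omega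
    obtain ⟨⟨x, hx⟩⟩ := (h3 0 hk).nonempty
    obtain ⟨u, hu, v, hv, huv⟩ := exists_adj_of_mem_of_notMem (S := {v | f v ≠ k})
      (hG.preconnected x y) (by simp only [Set.mem_ofPred_eq] at hx ⊢; omega) (by simpa using hy)
    simp only [Set.mem_ofPred_eq, ne_eq, not_not] at hu hv
    have huk : f u < k := lt_of_le_of_ne (h1 u) hu
    refine ih (Function.update f v (f u)) (fun w => ?_) (fun i hi w hw => ?_) (fun i hi => ?_) ?_
    · rcases eq_or_ne w v with rfl | hw
      · simpa using huk.le
      · simpa [hw] using h1 w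
    · rcases eq_or_ne w v with rfl | hwv
      · have := h2 i hi w hw
        omega
      · simpa [hwv] using h2 i hi w hw
    · rcases eq_or_ne i (f u) with rfl | hne
      · have : {w | Function.update f v (f u) w = f u} = insert v {w | f w = f u} := by
          ext w
          rcases eq_or_ne w v with rfl | hwv <;> simp [*]
        rw [this]
        exact connected_induce_insert (h3 _ hi) (u := u) rfl huv.symm
      · have : {w | Function.update f v (f u) w = i} = {w | f w = i} := by
          ext w
          rcases eq_or_ne w v with rfl | hwv
          · simp only [Function.update_self, Set.mem_ofPred_eq]
            omega
          · simp [*]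
        rw [this]
        exact h3 i hi
    · have : (Finset.univ.filter fun w => Function.update f v (f u) w = k)
          = (Finset.univ.filter fun w => f w = k).erase v := by
        ext w
        rcases eq_or_ne w v with rfl | hwv
        · simp [hu]
        · simp [hwv]
      rw [this, Finset.card_erase_of_mem (by simpa using hv), h4]
      rfl

/-- If `G` is connected and its vertices are labelled so that each label class is connected and
every edge of the pattern is realized between the classes of its ends, then the colouring of the
pattern extends to `G`: each class is spanned by a tree whose edges get private colours. -/
theorem Pattern.IsValid.rx_le_of_labelling {P : Pattern} (hP : P.IsValid) {V : Type*} [Finite V]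
    {G : SimpleGraph V} (f : V → ℕ) (hf : ∀ v, f v < P.order)
    (hconn : ∀ i < P.order, (G.induce {v | f v = i}).Connected)
    (hadj : ∀ d ∈ P.edges, ∃ u v, f u = d.1 ∧ f v = d.2.1 ∧ G.Adj u v) (hq : 0 < P.colors) :
    rx 3 G + P.order ≤ Nat.card V + P.colors := by
  classical
  have := Fintype.ofFinite V
  obtain ⟨hP1, hP2, hP3, hP4⟩ := hP
  have hroot : ∀ i : Fin P.order, ∃ r, f r = i := fun i => by
    obtain ⟨⟨r, hr⟩⟩ := (hconn i i.2).nonempty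
    exact ⟨r, hr⟩
  choose root hroot using hroot
  let R : Finset V := Finset.univ.image root
  have hinj : Function.Injective root := fun i j h => by
    have := hroot i
    rw [h, hroot j] at this
    exact Fin.ext this.symm
  have hR : R.card = P.order := by
    rw [Finset.card_image_of_injective _ hinj, Finset.card_univ, Fintype.card_fin]
  have hpar : ∀ v, v ∉ R → ∃ u, G.Adj v u ∧ f u = f v ∧
      ∀ (r : V) (hr : f r = f v), r ∈ R → ∃ hu : f u = f v,
        (G.induce {w | f w = f v}).dist ⟨u, hu⟩ ⟨r, hr⟩ <
          (G.induce {w | f w = f v}).dist ⟨v, rfl⟩ ⟨r, hr⟩ := by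
    intro v hv
    let i : Fin P.order := ⟨f v, hf v⟩
    obtain ⟨⟨u, hu⟩, h1, h2⟩ := Connected.exists_adj_dist_lt (hconn (f v) (hf v))
      ⟨root i, hroot i⟩ ⟨v, rfl⟩ (fun h => hv (Finset.mem_image.2
        ⟨i, Finset.mem_univ _, (congrArg Subtype.val h).symm⟩))
    refine ⟨u, h1, hu, fun r hr hrR => ⟨hu, ?_⟩⟩
    obtain ⟨j, -, rfl⟩ := Finset.mem_image.1 hrR
    obtain rfl : j = i := Fin.ext ((hroot j).symm.trans hr)
    exact h2
  choose! p hp1 hp2 hp3 using hpar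
  -- the private edges join every vertex to the root of its class
  let Φ : Set (Sym2 V) := {e | ∃ v, v ∉ R ∧ e = s(v, p v)}
  have hreach : ∀ n, ∀ v, (G.induce {w | f w = f v}).dist ⟨v, rfl⟩
      ⟨root ⟨f v, hf v⟩, hroot ⟨f v, hf v⟩⟩ = n →
      (fromEdgeSet Φ).Reachable v (root ⟨f v, hf v⟩) := by
    intro n
    induction n using Nat.strong_induction_on with
    | _ n ih =>
      intro v hn
      by_cases hv : v ∈ R
      · obtain ⟨j, -, rfl⟩ := Finset.mem_image.1 hv
        have : (⟨f (root j), hf _⟩ : Fin P.order) = j := Fin.ext (hroot j)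
        rw [this]
      · have hadj1 : (fromEdgeSet Φ).Adj v (p v) :=
          (fromEdgeSet_adj _).2 ⟨⟨v, hv, rfl⟩, (hp1 v hv).ne⟩
        refine hadj1.reachable.trans ?_
        obtain ⟨hu, hlt⟩ := hp3 v hv (root ⟨f v, hf v⟩) (hroot ⟨f v, hf v⟩)
          (Finset.mem_image_of_mem _ (Finset.mem_univ _))
        have key : ∀ (a b : ℕ) (h : a = b) (x r : V) (hx : f x = a) (hr : f r = a),
            (G.induce {w | f w = a}).dist ⟨x, hx⟩ ⟨r, hr⟩ =
              (G.induce {w | f w = b}).dist ⟨x, h ▸ hx⟩ ⟨r, h ▸ hr⟩ := by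
          rintro a _ rfl x r hx hr
          rfl
        have hroots : root ⟨f (p v), hf _⟩ = root ⟨f v, hf v⟩ :=
          congrArg root (Fin.ext (hp2 v hv))
        rw [← hroots]
        refine ih _ ?_ (p v) rfl
        rw [key _ _ (hp2 v hv)]
        simp only [hroots]
        omega
  have hreach' : ∀ v, (fromEdgeSet Φ).Reachable v (root ⟨f v, hf v⟩) := fun v => hreach _ v rfl
  -- private edges have pairwise distinct colours, the others have the colours of the pattern
  let φ : {v // v ∉ R} ≃ Fin (Fintype.card {v // v ∉ R}) := Fintype.equivFin _
  have hcardR : Fintype.card {v // v ∉ R} + P.order = Nat.card V := by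
    rw [Fintype.card_subtype_compl, Nat.card_eq_fintype_card, Fintype.card_coe, hR,
      Nat.sub_add_cancel]
    rw [← hR]
    exact Finset.card_le_univ R
  let c : Sym2 V → ℕ := fun e =>
    if h : ∃ v : {v // v ∉ R}, e = s((v : V), p v) then P.colors + φ h.choose
    else if h : ∃ d ∈ P.edges, ∃ u v, e = s(u, v) ∧ f u = d.1 ∧ f v = d.2.1 then h.choose.2.2
    else 0
  have hc1 : ∀ v : {v // v ∉ R}, P.colors ≤ c s((v : V), p v) := by
    intro v
    have h : ∃ w : {v // v ∉ R}, s((v : V), p v) = s((w : V), p w) := ⟨v, rfl⟩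
    simp only [c, dif_pos h]
    omega
  have hc1' : ∀ v w : {v // v ∉ R}, c s((v : V), p v) = c s((w : V), p w) →
      s((v : V), p v) = s((w : V), p w) := by
    intro v w hvw
    have h : ∃ u : {v // v ∉ R}, s((v : V), p v) = s((u : V), p u) := ⟨v, rfl⟩
    have h' : ∃ u : {v // v ∉ R}, s((w : V), p w) = s((u : V), p u) := ⟨w, rfl⟩
    simp only [c, dif_pos h, dif_pos h'] at hvw
    rw [h.choose_spec, h'.choose_spec]
    have : h.choose = h'.choose := φ.injective (Fin.ext (by omega))
    rw [this]
  have hc2 : ∀ d ∈ P.edges, ∀ u v, f u = d.1 → f v = d.2.1 → c s(u, v) = d.2.2 := by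
    intro d hd u v hu hv
    have hlt := (hP1 d hd).1
    have h1 : ¬ ∃ w : {v // v ∉ R}, s(u, v) = s((w : V), p w) := by
      rintro ⟨w, hw⟩
      have := hp2 w w.2
      rcases Sym2.eq_iff.1 hw with ⟨rfl, rfl⟩ | ⟨rfl, rfl⟩ <;> omega
    have h2 : ∃ d ∈ P.edges, ∃ u' v', s(u, v) = s(u', v') ∧ f u' = d.1 ∧ f v' = d.2.1 :=
      ⟨d, hd, u, v, rfl, hu, hv⟩
    simp only [c, dif_neg h1, dif_pos h2]
    obtain ⟨h3, u', v', h4, h5, h6⟩ := h2.choose_spec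
    have hlt' := (hP1 _ h3).1
    rcases Sym2.eq_iff.1 h4 with ⟨rfl, rfl⟩ | ⟨rfl, rfl⟩
    · rw [hP2 _ h3 d hd (by omega) (by omega)]
    · omega
  have hcN : ∀ e, c e < P.colors + Fintype.card {v // v ∉ R} := by
    intro e
    simp only [c]
    split_ifs with h1 h2
    · have := (φ h1.choose).2
      omega
    · have := (hP1 _ h2.choose_spec.1).2.2
      omega
    · omega
  have hmain : rx 3 G ≤ P.colors + Fintype.card {v // v ∉ R} := by
    refine rx_le_of_rainbow_reachable c hcN fun x y z => ?_
    obtain ⟨t, ht, hx, hy, hz⟩ :=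
      hP4 _ (List.mem_range.2 (hf x)) _ (List.mem_range.2 (hf y)) _ (List.mem_range.2 (hf z))
    obtain ⟨ht1, ht2, ht3⟩ := hP3 t ht
    have : Nonempty V := ⟨x⟩
    choose! u v hu hv huv using hadj
    let F : Set (Sym2 V) := Φ ∪ {e | ∃ d ∈ P.tree t, e = s(u d, v d)}
    have hΦF : fromEdgeSet Φ ≤ fromEdgeSet F := fromEdgeSet_mono Set.subset_union_left
    have hR : ∀ w, (fromEdgeSet F).Reachable w (root ⟨f w, hf w⟩) := fun w => (hreach' w).mono hΦF
    let S : ℕ → ℕ → Prop := fun i j => i = j ∨ ∃ (hi : i < P.order) (hj : j < P.order),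
      (fromEdgeSet F).Reachable (root ⟨i, hi⟩) (root ⟨j, hj⟩)
    have hS : Equivalence S := by
      refine ⟨fun i => Or.inl rfl, ?_, ?_⟩
      · rintro i j (rfl | ⟨hi, hj, h⟩)
        exacts [Or.inl rfl, Or.inr ⟨hj, hi, h.symm⟩]
      · rintro i j l (rfl | ⟨hi, hj, h⟩) (rfl | ⟨hj', hl, h'⟩)
        exacts [Or.inl rfl, Or.inr ⟨hj', hl, h'⟩, Or.inr ⟨hi, hj, h⟩, Or.inr ⟨hi, hl, h.trans h'⟩]
    have hStree := ht3.rel_of_mem_endpoints hS (fun d hd => by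
      have hdE := ht1 d hd
      have hd1 := hP1 d hdE
      refine Or.inr ⟨by omega, hd1.2.1, ?_⟩
      have e1 : (fromEdgeSet F).Adj (u d) (v d) :=
        (fromEdgeSet_adj _).2 ⟨Or.inr ⟨d, hd, rfl⟩, (huv d hdE).ne⟩
      have e2 := ((hR (u d)).symm.trans e1.reachable).trans (hR (v d))
      simp only [hu d hdE, hv d hdE] at e2
      exact e2)
    have hSR : ∀ a b : V, S (f a) (f b) → (fromEdgeSet F).Reachable a b := by
      rintro a b (h | ⟨ha, hb, h⟩)
      · have h1 := hR a
        simp only [h] at h1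
        exact h1.trans (hR b).symm
      · exact ((hR a).trans h).trans (hR b).symm
    refine ⟨F, ?_, ?_, hSR _ _ (hStree _ hx _ hy), hSR _ _ (hStree _ hx _ hz)⟩
    · rintro e (⟨w, hw, rfl⟩ | ⟨d, hd, rfl⟩)
      · exact hp1 w hw
      · exact huv d (ht1 d hd)
    · have hcol : ∀ d ∈ P.tree t, c s(u d, v d) = d.2.2 := fun d hd =>
        hc2 d (ht1 d hd) _ _ (hu d (ht1 d hd)) (hv d (ht1 d hd))
      rintro e (⟨w, hw, rfl⟩ | ⟨d, hd, rfl⟩) e' (⟨w', hw', rfl⟩ | ⟨d', hd', rfl⟩) hee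
      · exact hc1' ⟨w, hw⟩ ⟨w', hw'⟩ hee
      · have h1 := hc1 ⟨w, hw⟩
        have h2 := hP1 d' (ht1 d' hd')
        simp only [hee, hcol d' hd'] at h1
        omega
      · have h1 := hc1 ⟨w', hw'⟩
        have h2 := hP1 d (ht1 d hd)
        simp only [← hee, hcol d hd] at h1
        omega
      · rw [hcol d hd, hcol d' hd'] at hee
        rw [List.inj_on_of_nodup_map ht2 hd hd' hee]
  omega

/-- If a connected graph `G` contains a valid pattern as a minor, with branch sets given by lists of
vertices, then `G` needs at most `card V - order` colours more than the pattern. -/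
theorem Pattern.IsValid.rx_le {P : Pattern} (hP : P.IsValid) (hk : 0 < P.order)
    (hq : 0 < P.colors) {V : Type*} [Finite V]
    {G : SimpleGraph V} (hG : G.Connected) (B : List (List V)) (hlen : B.length = P.order)
    (hnd : B.flatten.Nodup) (hconn : ∀ l ∈ B, (G.induce {v | v ∈ l}).Connected)
    (hadj : ∀ d ∈ P.edges, ∃ u ∈ B.getD d.1 [], ∃ v ∈ B.getD d.2.1 [], G.Adj u v) :
    rx 3 G + P.order ≤ Nat.card V + P.colors := by
  rw [List.nodup_flatten] at hnd
  obtain ⟨f, hf1, hf2, hf3⟩ := exists_labelling hG hk (fun i => {v | v ∈ B.getD i []})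
    (fun i hi => by
      rw [← hlen] at hi
      refine hconn _ ?_
      rw [List.getD_eq_getElem _ _ hi]
      exact List.getElem_mem hi)
    (fun i hi j hj hij => by
      rw [← hlen] at hi hj
      have key : ∀ i j, i < j → (hi : i < B.length) → (hj : j < B.length) →
          List.Disjoint B[i] B[j] := fun i j hij hi hj =>
        List.pairwise_iff_getElem.1 hnd.2 i j hi hj hij
      rw [Set.disjoint_left]
      simp only [List.getD_eq_getElem _ _ hi, List.getD_eq_getElem _ _ hj, Set.mem_ofPred_eq]
      intro v hv hv'
      rcases lt_or_gt_of_ne hij with h | h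
      · exact key i j h hi hj hv hv'
      · exact key j i h hj hi hv' hv)
  refine hP.rx_le_of_labelling f hf1 hf3 (fun d hd => ?_) hq
  obtain ⟨u, hu, v, hv, huv⟩ := hadj d hd
  obtain ⟨h1, h2, -⟩ := hP.1 d hd
  exact ⟨u, v, hf2 _ (h1.trans h2) u hu, hf2 _ h2 v hv, huv⟩

/-! ### The patterns that save two or three colours -/

namespace Pattern

/-- The 4-cycle `0 1 2 3`. -/
def square : Pattern where
  order := 4
  colors := 2
  edges :=
      [(0, 1, 0), (1, 2, 1), (2, 3, 0), (0, 3, 1)]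
  trees :=
      [[1, 0], [3, 0], [2, 1], [3, 2]]

theorem isValid_square : square.IsValid := by decide +kernel

/-- Two triangles with the common vertex `0`. -/
def bowtie : Pattern where
  order := 5
  colors := 3
  edges :=
      [(0, 1, 0), (1, 2, 1), (0, 2, 0), (0, 3, 2), (3, 4, 1), (0, 4, 2)]
  trees :=
      [[3, 1, 0], [5, 1, 0], [4, 3, 0], [4, 3, 2]]

theorem isValid_bowtie : bowtie.IsValid := by decide +kernel

/-- The 6-cycle `0 1 2 3 4 5` with the long chord `0 3`. -/
def theta133 : Pattern where
  order := 6
  colors := 3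
  edges :=
      [(0, 1, 0), (1, 2, 1), (2, 3, 0), (3, 4, 2), (4, 5, 1), (0, 5, 2), (0, 3, 1)]
  trees :=
      [[5, 1, 0], [3, 6, 0], [4, 3, 2], [4, 5, 0], [6, 5, 0], [3, 2, 1], [6, 3, 2]]

theorem isValid_theta133 : theta133.IsValid := by decide +kernel

/-- The 7-cycle `0 1 2 3 4 5 6` with the chord `0 2`. -/
def theta125 : Pattern where
  order := 7
  colors := 4
  edges :=
      [(0, 1, 0), (1, 2, 1), (2, 3, 0), (3, 4, 2), (4, 5, 3), (5, 6, 1), (0, 6, 2), (0, 2, 3)]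
  trees :=
      [[4, 5, 6, 0], [4, 3, 2, 1], [6, 7, 2, 1], [5, 4, 3, 2], [7, 3, 2], [5, 6, 7, 2]]

theorem isValid_theta125 : theta125.IsValid := by decide +kernel

/-- Three internally disjoint paths of lengths `2`, `2` and `3` between `0` and `2`. -/
def theta223 : Pattern where
  order := 6
  colors := 3
  edges :=
      [(0, 1, 0), (1, 2, 1), (0, 3, 1), (2, 3, 0), (0, 4, 2), (4, 5, 1), (2, 5, 2)]
  trees :=
      [[4, 1, 0], [6, 3, 1], [4, 2, 0], [5, 4, 0], [6, 3, 2], [5, 6, 3]]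

theorem isValid_theta223 : theta223.IsValid := by decide +kernel

/-- A 5-cycle and a triangle with the common vertex `0`. -/
def pentagonTriangle : Pattern where
  order := 7
  colors := 4
  edges :=
      [(0, 1, 0), (1, 2, 1), (2, 3, 2), (3, 4, 0), (0, 4, 1), (0, 5, 3), (5, 6, 2), (0, 6, 3)]
  trees :=
      [[5, 2, 1, 0], [6, 5, 4, 0], [7, 4, 3, 2], [3, 2, 1], [7, 2, 1, 0], [5, 4, 3, 2],
       [6, 5, 1, 0], [6, 5, 4, 3]]

theorem isValid_pentagonTriangle : pentagonTriangle.IsValid := by decide +kernel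

/-- Two 4-cycles with the common vertex `0`. -/
def twoSquares : Pattern where
  order := 7
  colors := 4
  edges :=
      [(0, 1, 0), (1, 2, 1), (2, 3, 0), (0, 3, 1), (0, 4, 2), (4, 5, 3), (5, 6, 2), (0, 6, 3)]
  trees :=
      [[5, 4, 1, 0], [7, 4, 3, 0], [6, 7, 3, 2], [7, 4, 1, 0], [5, 4, 3, 0], [2, 1], [6, 5],
       [6, 7, 0], [4, 3, 2]]

theorem isValid_twoSquares : twoSquares.IsValid := by decide +kernel

/-- `K_{2,3}` with parts `0 1` and `2 3 4`, and a triangle at the vertex `0` of degree 3. -/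
def k23TriangleAtThree : Pattern where
  order := 7
  colors := 4
  edges :=
      [(0, 2, 0), (0, 3, 1), (0, 4, 2), (1, 2, 1), (1, 3, 0), (1, 4, 3), (0, 5, 2), (5, 6, 0),
       (0, 6, 3)]
  trees :=
      [[5, 2, 1, 0], [8, 6, 1, 0], [8, 3, 2, 0], [6, 5, 3, 0], [7, 8, 2, 1], [8, 6, 4, 1]]

theorem isValid_k23TriangleAtThree : k23TriangleAtThree.IsValid := by decide +kernel

/-- `K_{2,3}` with parts `0 1` and `2 3 4`, and a triangle at the vertex `2` of degree 2. -/
def k23TriangleAtTwo : Pattern where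
  order := 7
  colors := 4
  edges :=
      [(0, 2, 0), (0, 3, 1), (0, 4, 2), (1, 2, 0), (1, 3, 2), (1, 4, 1), (2, 5, 3), (5, 6, 1),
       (2, 6, 3)]
  trees :=
      [[6, 2, 1, 0], [8, 4, 1, 0], [6, 5, 2, 0], [7, 6, 2, 0], [8, 5, 4, 3], [7, 6, 4, 3]]

theorem isValid_k23TriangleAtTwo : k23TriangleAtTwo.IsValid := by decide +kernel

/-- `K_{2,4}` with parts `0 1` and `2 3 4 5`. -/
def k24 : Pattern where
  order := 6
  colors := 3
  edges :=
      [(0, 2, 0), (0, 3, 0), (0, 4, 1), (0, 5, 2), (1, 2, 1), (1, 3, 2), (1, 4, 0), (1, 5, 0)]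
  trees :=
      [[3, 2, 0], [5, 4, 0], [3, 2, 1], [6, 3, 2], [6, 5, 4], [7, 5, 4]]

theorem isValid_k24 : k24.IsValid := by decide +kernel

/-- The 6-cycle `0 1 2 3 4 5` with the two crossing short chords `0 2` and `1 3`. -/
def hexagonCrossing : Pattern where
  order := 6
  colors := 3
  edges :=
      [(0, 1, 0), (1, 2, 0), (2, 3, 0), (3, 4, 1), (4, 5, 0), (0, 5, 1), (0, 2, 2), (1, 3, 2)]
  trees :=
      [[3, 7, 0], [6, 5, 0], [3, 7, 1], [5, 6, 2], [7, 4, 3], [6, 5, 4]]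

theorem isValid_hexagonCrossing : hexagonCrossing.IsValid := by decide +kernel

/-- The 6-cycle `0 1 2 3 4 5` with the two short chords `0 2` and `3 5`, which do not cross. -/
def hexagonParallel : Pattern where
  order := 6
  colors := 3
  edges :=
      [(0, 1, 0), (1, 2, 1), (2, 3, 0), (3, 4, 2), (4, 5, 1), (0, 5, 2), (0, 2, 1), (3, 5, 1)]
  trees :=
      [[5, 1, 0], [3, 2, 1], [4, 5, 0], [7, 5, 0], [4, 3, 2], [6, 3, 2]]

theorem isValid_hexagonParallel : hexagonParallel.IsValid := by decide +kernel

/-- The complete graph on five vertices. -/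
def k5 : Pattern where
  order := 5
  colors := 2
  edges :=
      [(0, 1, 0), (0, 2, 0), (0, 3, 1), (0, 4, 1), (1, 2, 1), (1, 3, 0), (1, 4, 1), (2, 3, 1),
       (2, 4, 0), (3, 4, 0)]
  trees :=
      [[2, 0], [3, 0], [4, 0], [2, 1], [3, 1], [9, 2], [5, 4], [8, 4], [6, 5], [8, 7]]

theorem isValid_k5 : k5.IsValid := by decide +kernel

/-- Three triangles with the common vertex `0`. -/
def threeTriangles : Pattern where
  order := 7
  colors := 4
  edges :=
      [(0, 1, 0), (1, 2, 1), (0, 2, 0), (0, 3, 1), (3, 4, 2), (0, 4, 3), (0, 5, 1), (5, 6, 2),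
       (0, 6, 3)]
  trees :=
      [[4, 5, 1, 0], [7, 8, 1, 0], [8, 4, 3, 0], [6, 4, 5, 0], [7, 8, 3, 2], [7, 6, 5, 2]]

theorem isValid_threeTriangles : threeTriangles.IsValid := by decide +kernel

/-- A 4-cycle `0 1 2 3` with triangles at the opposite vertices `0` and `2`. -/
def squareOppositeTriangles : Pattern where
  order := 8
  colors := 5
  edges :=
      [(0, 1, 0), (1, 2, 1), (2, 3, 0), (0, 3, 1), (0, 4, 2), (4, 5, 3), (0, 5, 4), (2, 6, 2),
       (6, 7, 3), (2, 7, 4)]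
  trees :=
      [[9, 5, 4, 1, 0], [8, 9, 4, 3, 2], [7, 5, 6, 1, 0], [5, 4, 3, 0], [8, 7, 2, 1],
       [8, 7, 6, 3, 2]]

theorem isValid_squareOppositeTriangles : squareOppositeTriangles.IsValid := by decide +kernel

/-- A chain of the 4-cycle `0 1 2 3` and the triangles `0 4 5` and `4 6 7`. -/
def squareTriangleTriangle : Pattern where
  order := 8
  colors := 5
  edges :=
      [(0, 1, 0), (1, 2, 1), (2, 3, 2), (0, 3, 3), (0, 4, 4), (4, 5, 0), (0, 5, 2), (4, 6, 1),
       (6, 7, 2), (4, 7, 3)]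
  trees :=
      [[9, 4, 2, 1, 0], [7, 6, 4, 3, 0], [9, 6, 4, 1, 0], [8, 9, 4, 1, 0], [7, 5, 4, 3, 2],
       [8, 7, 5, 4, 3]]

theorem isValid_squareTriangleTriangle : squareTriangleTriangle.IsValid := by decide +kernel

/-- `K₄` and a triangle with the common vertex `0`. -/
def k4Triangle : Pattern where
  order := 6
  colors := 3
  edges :=
      [(0, 1, 0), (0, 2, 1), (0, 3, 2), (1, 2, 2), (1, 3, 1), (2, 3, 0), (0, 4, 0), (4, 5, 1),
       (0, 5, 2)]
  trees :=
      [[2, 1, 0], [7, 8, 0], [6, 2, 1], [8, 5, 1], [8, 1, 0], [8, 4, 0], [6, 3, 1], [8, 6, 1],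
       [6, 4, 2], [7, 6, 2]]

theorem isValid_k4Triangle : k4Triangle.IsValid := by decide +kernel

/-- A chain of the four triangles `0 1 2`, `2 3 4`, `4 5 6`, `6 7 8`. -/
def triangleChain : Pattern where
  order := 9
  colors := 6
  edges :=
      [(0, 1, 0), (1, 2, 1), (0, 2, 1), (2, 3, 0), (3, 4, 2), (2, 4, 3), (4, 5, 0), (5, 6, 2),
       (4, 6, 4), (6, 7, 5), (7, 8, 0), (6, 8, 5)]
  trees :=
      [[9, 8, 4, 5, 1, 0], [11, 7, 8, 5, 1, 0], [9, 7, 8, 5, 3, 1], [10, 9, 8, 4, 5, 1],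
       [11, 7, 8, 5, 3, 2], [10, 9, 7, 8, 5, 2]]

theorem isValid_triangleChain : triangleChain.IsValid := by decide +kernel

/-- A triangle `0 1 2` with a further triangle at each of its vertices. -/
def triangleStar : Pattern where
  order := 9
  colors := 6
  edges :=
      [(0, 1, 0), (1, 2, 0), (0, 2, 1), (0, 3, 2), (3, 4, 3), (0, 4, 2), (1, 5, 3), (5, 6, 4),
       (1, 6, 5), (2, 7, 3), (7, 8, 4), (2, 8, 5)]
  trees :=
      [[7, 8, 4, 3, 2, 0], [10, 11, 4, 3, 2, 0], [11, 7, 6, 3, 2, 0], [9, 7, 8, 3, 2, 0],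
       [10, 11, 6, 5, 2, 0], [10, 9, 8, 5, 2, 0]]

theorem isValid_triangleStar : triangleStar.IsValid := by decide +kernel

end Pattern

/-- The vertices in the list induce a connected subgraph. -/
def IsConn (G : SimpleGraph V) (l : List V) : Prop := (G.induce {v | v ∈ l}).Connected

theorem isConn_singleton (a : V) : IsConn G [a] := by
  have : {v | v ∈ [a]} = ({a} : Set V) := by
    ext
    simp
  unfold IsConn
  rw [this]
  exact connected_induce_singleton G a

theorem isConn_of_isChain : ∀ {l : List V}, l ≠ [] → l.IsChain G.Adj → IsConn G l
  | [], h, _ => absurd rfl h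
  | [a], _, _ => isConn_singleton a
  | a :: b :: l, _, h => by
    rw [List.isChain_cons_cons] at h
    have ih := isConn_of_isChain (List.cons_ne_nil b l) h.2
    have : {v | v ∈ a :: b :: l} = insert a {v | v ∈ b :: l} := by
      ext
      simp
    unfold IsConn
    rw [this]
    exact connected_induce_insert ih (u := b) List.mem_cons_self h.1

/-! ### Minors -/

/-- `P` is a minor of `G`: the branch sets are disjoint connected lists of vertices, in the order of
the vertices of `P`. -/
def Pattern.IsMinor (P : Pattern) (G : SimpleGraph V) : Prop :=
  ∃ B : List (List V), B.length = P.order ∧ B.flatten.Nodup ∧ (∀ l ∈ B, IsConn G l) ∧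
    ∀ d ∈ P.edges, ∃ u ∈ B.getD d.1 [], ∃ v ∈ B.getD d.2.1 [], G.Adj u v

/-- Three colours can be saved with respect to the number of vertices. -/
def SavesThree (G : SimpleGraph V) : Prop := rx 3 G + 3 ≤ Nat.card V

theorem Pattern.IsMinor.rx_le [Finite V] {P : Pattern} (h : P.IsMinor G) (hP : P.IsValid)
    (hG : G.Connected) (hk : 0 < P.order) (hq : 0 < P.colors) :
    rx 3 G + P.order ≤ Nat.card V + P.colors := by
  obtain ⟨B, h1, h2, h4, h5⟩ := h
  exact hP.rx_le hk hq hG B h1 h2 h4 h5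

theorem Pattern.IsMinor.savesThree [Finite V] {P : Pattern} (h : P.IsMinor G)
    (hP : P.IsValid) (hG : G.Connected) (h3 : P.order = P.colors + 3) (hq : 0 < P.colors) :
    SavesThree G := by
  have := h.rx_le hP hG (by omega) hq
  unfold SavesThree
  omega

/-! ### Cycles and ears as lists of vertices -/

/-- The list runs once around a cycle of `G`; its last and first vertex are adjacent, too. -/
def IsCyc (G : SimpleGraph V) (l : List V) : Prop :=
  3 ≤ l.length ∧ l.Nodup ∧ Cycle.Chain G.Adj (l : Cycle V)

theorem IsCyc.rotate {s t : List V} (h : IsCyc G (s ++ t)) : IsCyc G (t ++ s) := by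
  obtain ⟨h1, h2, h3⟩ := h
  refine ⟨by simpa [add_comm] using h1, (List.perm_append_comm).nodup h2, ?_⟩
  have : ((t ++ s : List V) : Cycle V) = (s ++ t : List V) :=
    Cycle.coe_eq_coe.2 List.isRotated_append
  rwa [this]

theorem isCyc_cons {a : V} {l : List V} :
    IsCyc G (a :: l) ↔ 2 ≤ l.length ∧ (a :: l).Nodup ∧ (a :: (l ++ [a])).IsChain G.Adj := by
  unfold IsCyc
  rw [Cycle.chain_coe_cons]
  simp

theorem IsCyc.exists_perm_cons {l : List V} (h : IsCyc G l) {a : V} (ha : a ∈ l) :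
    ∃ t, IsCyc G (a :: t) ∧ (a :: t).Perm l := by
  obtain ⟨s, t, rfl⟩ := List.append_of_mem ha
  exact ⟨t ++ s, h.rotate, by simpa using List.perm_append_comm (l₁ := a :: t) (l₂ := s)⟩

theorem IsCyc.exists_perm_cons_append_cons {l : List V} (h : IsCyc G l) {a b : V} (ha : a ∈ l)
    (hb : b ∈ l) (hab : a ≠ b) :
    ∃ s t, IsCyc G (a :: (s ++ b :: t)) ∧ (a :: (s ++ b :: t)).Perm l := by
  obtain ⟨t, h1, h2⟩ := h.exists_perm_cons ha
  have : b ∈ t := by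
    have := h2.mem_iff.2 hb
    rw [List.mem_cons] at this
    exact this.resolve_left hab.symm
  obtain ⟨u, w, rfl⟩ := List.append_of_mem this
  exact ⟨u, w, h1, h2⟩

theorem isChain_cons_append_cons {a b : V} {s t : List V} :
    (a :: (s ++ b :: t)).IsChain G.Adj ↔
      (a :: (s ++ [b])).IsChain G.Adj ∧ (b :: t).IsChain G.Adj := by
  rw [← List.cons_append, List.isChain_split, List.cons_append]

/-- A cycle through `a` and `b` consists of two paths between them. -/
theorem isCyc_cons_append_cons {a b : V} {s t : List V} :
    IsCyc G (a :: (s ++ b :: t)) ↔ 1 ≤ s.length + t.length ∧ (a :: (s ++ b :: t)).Nodup ∧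
      (a :: (s ++ [b])).IsChain G.Adj ∧ (b :: (t ++ [a])).IsChain G.Adj := by
  rw [isCyc_cons, List.append_assoc, List.cons_append, isChain_cons_append_cons]
  simp only [List.length_append, List.length_cons]
  constructor
  · rintro ⟨h1, h2, h3⟩
    exact ⟨by omega, h2, h3⟩
  · rintro ⟨h1, h2, h3⟩
    exact ⟨by omega, h2, h3⟩

theorem isChain_reverse_adj {l : List V} (h : l.IsChain G.Adj) : l.reverse.IsChain G.Adj := by
  rw [List.isChain_reverse]
  exact h.imp fun _ _ h => h.symm

theorem isChain_reverse_ends {a b : V} {s : List V} (h : (a :: (s ++ [b])).IsChain G.Adj) :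
    (b :: (s.reverse ++ [a])).IsChain G.Adj := by
  simpa using isChain_reverse_adj h

theorem exists_adj_of_isChain_append {s t : List V} (h : (s ++ t).IsChain G.Adj) (hs : s ≠ [])
    (ht : t ≠ []) : ∃ u ∈ s, ∃ v ∈ t, G.Adj u v := by
  rw [List.isChain_append] at h
  exact ⟨s.getLast hs, List.getLast_mem hs, t.head ht, List.head_mem ht,
    h.2.2 _ (by simp [List.getLast?_eq_getLast_of_ne_nil hs]) _
      (by simp [List.head?_eq_some_head ht])⟩

theorem length_le_card_of_nodup [Finite V] {l : List V} (h : l.Nodup) :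
    l.length ≤ Nat.card V := by
  have := Fintype.ofFinite V
  rw [Nat.card_eq_fintype_card]
  exact h.length_le_card

theorem exists_longest_cyc [Finite V] (h : ∃ l, IsCyc G l) :
    ∃ l, IsCyc G l ∧ ∀ l', IsCyc G l' → l'.length ≤ l.length := by
  classical
  obtain ⟨l, hl⟩ := h
  let p : ℕ → Prop := fun n => ∃ l, IsCyc G l ∧ l.length = n
  obtain ⟨l₀, h1, h2⟩ : p (Nat.findGreatest p (Nat.card V)) :=
    Nat.findGreatest_spec (P := p) (length_le_card_of_nodup hl.2.1) ⟨l, hl, rfl⟩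
  refine ⟨l₀, h1, fun l' h' => ?_⟩
  rw [h2]
  exact Nat.le_findGreatest (length_le_card_of_nodup h'.2.1) ⟨l', h', rfl⟩

/-- `p` lists the inner vertices of an ear of `A` from `a` to `b`. If `a = b`, then the ear is a
cycle that meets `A` in `a`. -/
structure IsEar (G : SimpleGraph V) (A : List V) (a b : V) (p : List V) : Prop where
  left_mem : a ∈ A
  right_mem : b ∈ A
  ne_nil : p ≠ []
  nodup : p.Nodup
  chain : (a :: (p ++ [b])).IsChain G.Adj
  disjoint : ∀ x ∈ p, x ∉ A
  two_le : a = b → 2 ≤ p.length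

theorem IsEar.reverse {A : List V} {a b : V} {p : List V} (h : IsEar G A a b p) :
    IsEar G A b a p.reverse where
  left_mem := h.right_mem
  right_mem := h.left_mem
  ne_nil := by simpa using h.ne_nil
  nodup := by simpa using h.nodup
  chain := isChain_reverse_ends h.chain
  disjoint := by simpa using h.disjoint
  two_le := fun e => by simpa using h.two_le e.symm

theorem exists_prefix_of_walk {A : List V} : ∀ {x a : V} (w : G.Walk x a), x ∉ A → a ∈ A →
    ∃ p b, b ∈ A ∧ (x :: p) ++ [b] <+: w.support ∧ ∀ y ∈ x :: p, y ∉ A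
  | _, _, .nil, hx, ha => absurd ha hx
  | x, a, .cons (v := y) h q, hx, ha => by
    by_cases hy : y ∈ A
    · refine ⟨[], y, hy, ?_, by simpa using hx⟩
      exact List.prefix_append_right_inj [x] |>.2 ⟨q.support.tail, by simp⟩
    · obtain ⟨p, b, hb, h1, h2⟩ := exists_prefix_of_walk q hy ha
      refine ⟨y :: p, b, hb, ?_, ?_⟩
      · rw [Walk.support_cons]
        simpa using h1
      · intro z hz
        rcases List.mem_cons.1 hz with rfl | hz
        exacts [hx, h2 z hz]

/-- In a 2-edge-connected graph every proper nonempty set of vertices has an ear. -/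
theorem exists_isEar (hE : G.IsEdgeConnected 2) {A : List V} {a₀ v : V} (ha : a₀ ∈ A)
    (hv : v ∉ A) : ∃ a b p, IsEar G A a b p := by
  classical
  obtain ⟨a, ha, x, hx, hax⟩ := exists_adj_of_mem_of_notMem (S := {v | v ∈ A})
    (hE.preconnected two_ne_zero a₀ v) ha hv
  simp only [Set.mem_ofPred_eq] at ha hx
  -- `x` still reaches `a` when the edge `s(a, x)` is deleted
  obtain ⟨w, hw⟩ := (isEdgeConnected_two.1 hE s(a, x) x a).exists_isPath
  obtain ⟨p, b, hb, h1, h2⟩ := exists_prefix_of_walk w hx ha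
  have hchain : ((x :: p) ++ [b]).IsChain (G.deleteEdges {s(a, x)}).Adj :=
    w.isChain_adj_support.prefix h1
  refine ⟨a, b, x :: p, ha, hb, by simp, ?_, ?_, h2, ?_⟩
  · exact hw.support_nodup.sublist ((List.sublist_append_left _ _).trans h1.sublist)
  · rw [List.cons_append, List.isChain_cons_cons]
    exact ⟨hax, hchain.imp fun _ _ h => (deleteEdges_adj.1 h).1⟩
  · rintro rfl
    rcases p with _ | ⟨y, p⟩
    · simp [deleteEdges_adj, Sym2.eq_swap] at hchain
    · simp

theorem exists_isCyc [Nontrivial V] (hE : G.IsEdgeConnected 2) : ∃ l, IsCyc G l := by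
  obtain ⟨r, v, hrv⟩ := exists_pair_ne V
  obtain ⟨a, b, p, h⟩ := exists_isEar hE (A := [r]) (List.mem_singleton.2 rfl)
    (v := v) (by simpa using hrv.symm)
  obtain rfl := List.mem_singleton.1 h.left_mem
  obtain rfl := List.mem_singleton.1 h.right_mem
  exact ⟨b :: p, isCyc_cons.2 ⟨h.two_le rfl,
    List.nodup_cons.2 ⟨fun hb => h.disjoint b hb h.left_mem, h.nodup⟩, h.chain⟩⟩

/-- Replacing an arc of a cycle by an ear. -/
theorem IsCyc.replace {A : List V} {a b : V} {s t p : List V} (h : IsCyc G (a :: (s ++ b :: t)))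
    (hp : IsEar G A a b p) (hA : ∀ x ∈ a :: (s ++ b :: t), x ∈ A) :
    IsCyc G (a :: (p ++ b :: t)) := by
  rw [isCyc_cons_append_cons] at h ⊢
  obtain ⟨-, h2, -, h4⟩ := h
  refine ⟨?_, ?_, hp.chain, h4⟩
  · have := List.length_pos_iff.2 hp.ne_nil
    omega
  · have hd := hp.disjoint
    have hn := hp.nodup
    simp only [List.nodup_cons, List.nodup_append, List.mem_append, List.mem_cons] at h2 hA ⊢
    grind

/-! ### Patterns from a cycle with an ear or a chord -/

theorem exists_adj_of_isChain_ends {a b : V} {s : List V} (h : (a :: (s ++ [b])).IsChain G.Adj)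
    (hs : s ≠ []) : (∃ x ∈ s, G.Adj a x) ∧ ∃ x ∈ s, G.Adj b x := by
  have h1 := exists_adj_of_isChain_append (s := [a]) (t := s ++ [b]) h (by simp) (by simp)
  have h2 := exists_adj_of_isChain_append (s := s) (t := [b]) h.tail hs (by simp)
  constructor
  · rcases s with _ | ⟨x, s⟩
    · exact absurd rfl hs
    · simp only [List.cons_append, List.isChain_cons_cons] at h
      exact ⟨x, by simp, h.1⟩
  · obtain ⟨u, hu, v, hv, huv⟩ := h2
    rw [List.mem_singleton] at hv
    subst hv
    exact ⟨u, hu, huv.symm⟩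

theorem isConn_of_isChain_ends {a b : V} {s : List V} (h : (a :: (s ++ [b])).IsChain G.Adj)
    (hs : s ≠ []) : IsConn G s :=
  isConn_of_isChain hs h.tail.left_of_append

theorem theta223_isMinor {A : List V} {a b : V} {s t p : List V}
    (h : IsCyc G (a :: (s ++ b :: t))) (hA : ∀ x ∈ a :: (s ++ b :: t), x ∈ A)
    (hp : IsEar G A a b p) (hs : s ≠ []) (ht : 2 ≤ t.length) : Pattern.theta223.IsMinor G := by
  obtain ⟨-, h2, h3, h4⟩ := isCyc_cons_append_cons.1 h
  rcases t with _ | ⟨y, _ | ⟨z, t⟩⟩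
  · simp at ht
  · simp at ht
  simp only [List.cons_append, List.isChain_cons_cons] at h4
  obtain ⟨h5, h6, h7⟩ := h4
  have e1 := exists_adj_of_isChain_ends hp.chain hp.ne_nil
  have e2 := exists_adj_of_isChain_ends h3 hs
  have e3 := exists_adj_of_isChain_ends (s := z :: t) (List.isChain_cons_cons.2 ⟨h6, h7⟩) (by simp)
  refine ⟨[[a], p, [b], s, z :: t, [y]], rfl, ?_, ?_, ?_⟩
  · have hd := hp.disjoint
    have hn := hp.nodup
    simp [List.nodup_append] at h2 hA ⊢
    grind
  · have c1 := isConn_of_isChain_ends hp.chain hp.ne_nil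
    have c2 := isConn_of_isChain_ends h3 hs
    have c3 := isConn_of_isChain_ends (a := y) (s := z :: t) (List.isChain_cons_cons.2 ⟨h6, h7⟩)
      (by simp)
    simp [isConn_singleton, c1, c2, c3]
  · simp [Pattern.theta223] at e1 e2 e3 ⊢
    grind [G.adj_comm]

theorem pentagonTriangle_isMinor {A : List V} {a : V} {t p : List V}
    (h : IsCyc G (a :: t)) (hA : ∀ x ∈ a :: t, x ∈ A)
    (hp : IsEar G A a a p) (ht : 4 ≤ t.length) : Pattern.pentagonTriangle.IsMinor G := by
  obtain ⟨-, h2, h3⟩ := isCyc_cons.1 h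
  obtain ⟨x1, x2, x3, x4, t, rfl⟩ : ∃ x1 x2 x3 x4 t', t = x1 :: x2 :: x3 :: x4 :: t' := by
    rcases t with _ | ⟨x1, _ | ⟨x2, _ | ⟨x3, _ | ⟨x4, t⟩⟩⟩⟩
    all_goals simp at ht ⊢
  obtain ⟨y, z, p, rfl⟩ : ∃ y z p', p = y :: z :: p' := by
    have := hp.two_le rfl
    rcases p with _ | ⟨x1, _ | ⟨x2, p⟩⟩
    all_goals simp at this ⊢
  have hc := hp.chain
  simp only [List.cons_append, List.isChain_cons_cons] at h3 hc
  obtain ⟨h4, h5, h6, h7, h8⟩ := h3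
  obtain ⟨h9, h10, h11⟩ := hc
  have e1 := exists_adj_of_isChain_ends (s := x4 :: t) (List.isChain_cons_cons.2 ⟨h7, h8⟩) (by simp)
  have e2 := exists_adj_of_isChain_ends (s := z :: p) (List.isChain_cons_cons.2 ⟨h10, h11⟩)
    (by simp)
  refine ⟨[[a], [x1], [x2], [x3], x4 :: t, [y], z :: p], rfl, ?_, ?_, ?_⟩
  · have hd := hp.disjoint
    have hn := hp.nodup
    simp [List.nodup_append] at h2 hA hn ⊢
    grind
  · have c1 := isConn_of_isChain_ends (a := x3) (s := x4 :: t) (List.isChain_cons_cons.2 ⟨h7, h8⟩)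
      (by simp)
    have c2 := isConn_of_isChain_ends (a := y) (s := z :: p) (List.isChain_cons_cons.2 ⟨h10, h11⟩)
      (by simp)
    simp [isConn_singleton, c1, c2]
  · simp [Pattern.pentagonTriangle] at e1 e2 ⊢
    grind [G.adj_comm]

theorem theta133_isMinor {a b : V} {s t : List V} (h : IsCyc G (a :: (s ++ b :: t)))
    (hab : G.Adj a b) (hs : 2 ≤ s.length) (ht : 2 ≤ t.length) : Pattern.theta133.IsMinor G := by
  obtain ⟨-, h2, h3, h4⟩ := isCyc_cons_append_cons.1 h
  rcases t with _ | ⟨y, _ | ⟨z, t⟩⟩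
  · simp at ht
  · simp at ht
  rcases s with _ | ⟨u, _ | ⟨v, s⟩⟩
  · simp at hs
  · simp at hs
  simp only [List.cons_append, List.isChain_cons_cons] at h3 h4
  obtain ⟨h5, h6, h7⟩ := h4
  obtain ⟨h8, h9, h10⟩ := h3
  have e1 := exists_adj_of_isChain_ends (s := z :: t) (List.isChain_cons_cons.2 ⟨h6, h7⟩) (by simp)
  have e2 := exists_adj_of_isChain_ends (s := v :: s) (List.isChain_cons_cons.2 ⟨h9, h10⟩) (by simp)
  refine ⟨[[a], [u], v :: s, [b], [y], z :: t], rfl, ?_, ?_, ?_⟩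
  · simp [List.nodup_append] at h2 ⊢
    grind
  · have c1 := isConn_of_isChain_ends (a := y) (s := z :: t) (List.isChain_cons_cons.2 ⟨h6, h7⟩)
      (by simp)
    have c2 := isConn_of_isChain_ends (a := u) (s := v :: s) (List.isChain_cons_cons.2 ⟨h9, h10⟩)
      (by simp)
    simp [isConn_singleton, c1, c2]
  · simp [Pattern.theta133] at e1 e2 ⊢
    grind [G.adj_comm]

theorem theta125_isMinor {a b c : V} {t : List V} (h : IsCyc G (a :: ([c] ++ b :: t)))
    (hab : G.Adj a b) (ht : 4 ≤ t.length) : Pattern.theta125.IsMinor G := by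
  obtain ⟨-, h2, h3, h4⟩ := isCyc_cons_append_cons.1 h
  obtain ⟨x1, x2, x3, x4, t, rfl⟩ : ∃ x1 x2 x3 x4 t', t = x1 :: x2 :: x3 :: x4 :: t' := by
    rcases t with _ | ⟨x1, _ | ⟨x2, _ | ⟨x3, _ | ⟨x4, t⟩⟩⟩⟩
    all_goals simp at ht ⊢
  simp only [List.cons_append, List.nil_append, List.isChain_cons_cons] at h3 h4
  obtain ⟨h5, h6, h7, h8, h9⟩ := h4
  obtain ⟨h10, h11, -⟩ := h3
  have e1 := exists_adj_of_isChain_ends (s := x4 :: t) (List.isChain_cons_cons.2 ⟨h8, h9⟩) (by simp)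
  refine ⟨[[a], [c], [b], [x1], [x2], [x3], x4 :: t], rfl, ?_, ?_, ?_⟩
  · simp at h2 ⊢
    grind
  · have c1 := isConn_of_isChain_ends (a := x3) (s := x4 :: t) (List.isChain_cons_cons.2 ⟨h8, h9⟩)
      (by simp)
    simp [isConn_singleton, c1]
  · simp [Pattern.theta125] at e1 ⊢
    grind [G.adj_comm]

/-! ### Graphs with a cycle of length at least five -/

/-- A longest cycle cannot be rerouted through an ear, so the ends of an ear, if distinct, cut it into
arcs with inner vertices, one of them with at least two. -/
theorem saves_of_notMem_longest_cyc (hE : G.IsEdgeConnected 2) {l : List V} (hl : IsCyc G l)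
    (hmax : ∀ l', IsCyc G l' → l'.length ≤ l.length) (h5 : 5 ≤ l.length) {v : V} (hv : v ∉ l) :
    Pattern.theta223.IsMinor G ∨ Pattern.pentagonTriangle.IsMinor G := by
  obtain ⟨x, hx⟩ : ∃ x, x ∈ l := ⟨l[0], List.getElem_mem _⟩
  obtain ⟨a, b, p, hp⟩ := exists_isEar hE hx hv
  by_cases hab : a = b
  · subst hab
    obtain ⟨t, h1, h2⟩ := hl.exists_perm_cons hp.left_mem
    have := h2.length_eq
    simp only [List.length_cons] at this
    exact Or.inr (pentagonTriangle_isMinor h1 (fun x hx => h2.mem_iff.1 hx) hp (by omega))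
  · obtain ⟨s, t, h1, h2⟩ := hl.exists_perm_cons_append_cons hp.left_mem hp.right_mem hab
    have hA : ∀ x ∈ a :: (s ++ b :: t), x ∈ l := fun x hx => h2.mem_iff.1 hx
    have h1' : IsCyc G (b :: (t ++ a :: s)) := by
      simpa using IsCyc.rotate (s := a :: s) (t := b :: t) (by simpa using h1)
    have hA' : ∀ x ∈ b :: (t ++ a :: s), x ∈ l := fun x hx => hA x (by
      simp only [List.mem_cons, List.mem_append] at hx ⊢
      tauto)
    have hlen := h2.length_eq
    have hp1 := List.length_pos_iff.2 hp.ne_nil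
    have m1 := hmax _ (h1.replace hp hA)
    have m2 := hmax _ (h1'.replace hp.reverse hA')
    simp only [List.length_cons, List.length_append, List.length_reverse] at hlen m1 m2
    by_cases ht : 2 ≤ t.length
    · exact Or.inl (theta223_isMinor h1 hA hp (List.length_pos_iff.1 (by omega)) ht)
    · exact Or.inl (theta223_isMinor h1' hA' hp.reverse (List.length_pos_iff.1 (by omega))
        (by omega))

theorem isTwoConnected_of_isCyc [Finite V] {l : List V} (hl : IsCyc G l) (hcov : ∀ v, v ∈ l) :
    IsTwoConnected G := by
  have hrest : ∀ v, (G.induce {v}ᶜ).Connected ∧ G.Connected := by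
    intro v
    obtain ⟨t, h1, h2⟩ := hl.exists_perm_cons (hcov v)
    obtain ⟨h3, h4, h5⟩ := isCyc_cons.1 h1
    have ht : t ≠ [] := List.length_pos_iff.1 (by omega)
    have key : ∀ x, x ∈ v :: t := fun x => h2.mem_iff.2 (hcov x)
    rw [List.nodup_cons] at h4
    have hc : IsConn G t := isConn_of_isChain_ends h5 ht
    have e1 : {x | x ∈ t} = ({v}ᶜ : Set V) := by
      ext x
      have := key x
      simp only [List.mem_cons] at this
      simp only [Set.mem_ofPred_eq, Set.mem_compl_iff, Set.mem_singleton_iff]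
      constructor
      · rintro h rfl
        exact h4.1 h
      · tauto
    have hc2 : IsConn G (v :: t) :=
      isConn_of_isChain (by simp) (List.IsChain.left_of_append (l₂ := [v]) h5)
    have e2 : {x | x ∈ v :: t} = (Set.univ : Set V) := by
      ext x
      simpa using key x
    unfold IsConn at hc hc2
    rw [e1] at hc
    rw [e2] at hc2
    exact ⟨hc, (induceUnivIso G).connected_iff.1 hc2⟩
  have hlen : 3 ≤ Nat.card V := hl.1.trans (length_le_card_of_nodup hl.2.1)
  refine ⟨hlen, ?_, fun v => (hrest v).1⟩
  exact (hrest (l[0]'(by have := hl.1; omega))).2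

theorem card_eq_length [Finite V] {l : List V} (hnd : l.Nodup) (hcov : ∀ v, v ∈ l) :
    Nat.card V = l.length := by
  classical
  have e := List.Nodup.getEquivOfForallMemList l hnd hcov
  rw [← Nat.card_congr e, Nat.card_eq_fintype_card, Fintype.card_fin]

/-- If a Hamiltonian cycle has no chords, in any of its cyclic splittings `a s b t`, then `G` is a
cycle. -/
theorem iso_cycleGraph_of_chordless [Finite V] {l : List V} (hl : IsCyc G l) (hcov : ∀ v, v ∈ l)
    (hch : ∀ a b s t, IsCyc G (a :: (s ++ b :: t)) → (a :: (s ++ b :: t)).length = l.length →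
      G.Adj a b → s = [] ∨ t = []) :
    Nonempty (G ≃g cycleGraph (Nat.card V)) := by
  classical
  rw [card_eq_length hl.2.1 hcov]
  have h3 := hl.1
  have hsplit : ∀ i j (hi : i < l.length) (hj : j < l.length), i < j →
      ∃ s t, IsCyc G (l[i] :: (s ++ l[j] :: t)) ∧ s.length = j - i - 1 ∧
        t.length = l.length - 1 - j + i := by
    intro i j hi hj hij
    have e1 : l = l.take i ++
        l[i] :: ((l.drop (i + 1)).take (j - i - 1) ++ l[j] :: l.drop (j + 1)) := by
      have f1 : l.drop i = l[i] :: l.drop (i + 1) := List.drop_eq_getElem_cons hi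
      have f2 : (l.drop (i + 1)).drop (j - i - 1) = l[j] :: l.drop (j + 1) := by
        rw [List.drop_drop, ← List.drop_eq_getElem_cons hj]
        congr 1
        omega
      rw [← f2, List.take_append_drop, ← f1, List.take_append_drop]
    refine ⟨(l.drop (i + 1)).take (j - i - 1), l.drop (j + 1) ++ l.take i, ?_, ?_, ?_⟩
    · rw [e1] at hl
      simpa only [List.cons_append, List.append_assoc] using hl.rotate
    · simp only [List.length_take, List.length_drop]
      omega
    · simp only [List.length_append, List.length_take, List.length_drop]
      omega
  have key : ∀ i j (hi : i < l.length) (hj : j < l.length), i < j →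
      (G.Adj l[i] l[j] ↔ j = i + 1 ∨ (i = 0 ∧ j = l.length - 1)) := by
    intro i j hi hj hij
    obtain ⟨s, t, h1, h2, h4⟩ := hsplit i j hi hj hij
    constructor
    · intro h
      rcases hch _ _ s t h1 (by simp only [List.length_cons, List.length_append]; omega) h
        with rfl | rfl
      · simp only [List.length_nil] at h2
        omega
      · simp only [List.length_nil] at h4
        omega
    · obtain ⟨-, -, c1, c2⟩ := isCyc_cons_append_cons.1 h1
      rintro (h | h)
      · have : s = [] := List.length_eq_zero_iff.1 (by omega)
        subst this
        simpa using c1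
      · have : t = [] := List.length_eq_zero_iff.1 (by omega)
        subst this
        simpa [G.adj_comm] using c2
  refine ⟨(RelIso.symm ⟨List.Nodup.getEquivOfForallMemList l hl.2.1 hcov, ?_⟩)⟩
  intro i j
  rw [cycleGraph_adj']
  change G.Adj l[i] l[j] ↔ _
  rcases lt_trichotomy i j with h | h | h
  · have := key i j i.2 j.2 h
    rw [Fin.getElem_fin, Fin.getElem_fin, this, Fin.sub_val_of_le h.le, Fin.coe_sub_iff_lt.2 h]
    have := i.2
    have := j.2
    rw [Fin.lt_def] at h
    omega
  · subst h
    have : NeZero l.length := ⟨by omega⟩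
    simp
  · have := key j i j.2 i.2 h
    rw [G.adj_comm, Fin.getElem_fin, Fin.getElem_fin, this, Fin.sub_val_of_le h.le,
      Fin.coe_sub_iff_lt.2 h]
    have := i.2
    have := j.2
    rw [Fin.lt_def] at h
    omega

instance decidableOfEdgesAdj {n : ℕ} (l : List (Sym2 (Fin n))) : DecidableRel (ofEdges l).Adj :=
  fun u v => decidable_of_iff (s(u, v) ∈ l ∧ u ≠ v) (by simp [ofEdges])

theorem bijective_of_nodup {n : ℕ} {w : Fin n → V} (hnd : (List.ofFn w).Nodup)
    (hcov : ∀ v, v ∈ List.ofFn w) : Function.Bijective w :=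
  ⟨List.nodup_ofFn.1 hnd, fun v => by simpa [List.mem_ofFn] using hcov v⟩

theorem isSpanningSubgraphOf_of_bijective {W : Type*} {H : SimpleGraph W} {w : W → V}
    (hw : Function.Bijective w) (h : ∀ i j, G.Adj (w i) (w j) → H.Adj i j) :
    IsSpanningSubgraphOf G H :=
  ⟨(Equiv.ofBijective w hw).symm, fun u v huv => h _ _ (by
    rwa [Equiv.ofBijective_apply_symm_apply w hw, Equiv.ofBijective_apply_symm_apply w hw])⟩

theorem nonempty_iso_of_bijective {W : Type*} {H : SimpleGraph W} {w : W → V}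
    (hw : Function.Bijective w) (h : ∀ i j, G.Adj (w i) (w j) ↔ H.Adj i j) :
    Nonempty (G ≃g H) :=
  ⟨RelIso.symm ⟨Equiv.ofBijective w hw, h _ _⟩⟩

theorem isSpanningSubgraphOf_threeSun {a b c d e f : V} (hnd : [a, b, c, d, e, f].Nodup)
    (hcov : ∀ v, v ∈ [a, b, c, d, e, f]) (h1 : ¬ G.Adj a c) (h2 : ¬ G.Adj a e) (h3 : ¬ G.Adj c e)
    (h4 : ¬ G.Adj a d) (h5 : ¬ G.Adj b e) (h6 : ¬ G.Adj c f) :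
    IsSpanningSubgraphOf G threeSun := by
  refine isSpanningSubgraphOf_of_bijective (w := ![a, b, c, d, e, f])
    (bijective_of_nodup (by simpa using hnd) (by simpa using hcov)) ?_
  intro i j hij
  by_contra hn
  revert hij
  fin_cases i <;> fin_cases j <;> first
    | exact absurd (by unfold threeSun; decide) hn
    | simp [G.adj_comm, *]

theorem isSpanningSubgraphOf_K5MinusEdge {a b c d e : V} (hnd : [a, b, c, d, e].Nodup)
    (hcov : ∀ v, v ∈ [a, b, c, d, e]) (h1 : ¬ G.Adj a b) :
    IsSpanningSubgraphOf G K5MinusEdge := by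
  refine isSpanningSubgraphOf_of_bijective (w := ![a, b, c, d, e])
    (bijective_of_nodup (by simpa using hnd) (by simpa using hcov)) ?_
  intro i j hij
  by_contra hn
  revert hij
  fin_cases i <;> fin_cases j <;> first
    | (simp [K5MinusEdge] at hn; done)
    | simp [G.adj_comm, *]

/-- Two short chords of a 6-cycle that do not share an end save a third colour. -/
theorem hexagon_isMinor_of_adj {a b c d e f : V} (h : IsCyc G [a, b, c, d, e, f]) (hac : G.Adj a c)
    (h2 : G.Adj b d ∨ G.Adj d f ∨ G.Adj f b) :
    Pattern.hexagonCrossing.IsMinor G ∨ Pattern.hexagonParallel.IsMinor G := by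
  obtain ⟨-, hnd, hc⟩ := isCyc_cons.1 h
  simp only [List.cons_append, List.nil_append, List.isChain_cons_cons] at hc
  obtain ⟨e1, e2, e3, e4, e5, e6, -⟩ := hc
  rcases h2 with h2 | h2 | h2
  · refine Or.inl ⟨[[a], [b], [c], [d], [e], [f]], rfl, by simpa using hnd,
      by simp [isConn_singleton], ?_⟩
    simp [Pattern.hexagonCrossing]
    grind [G.adj_comm]
  · refine Or.inr ⟨[[a], [b], [c], [d], [e], [f]], rfl, by simpa using hnd,
      by simp [isConn_singleton], ?_⟩
    simp [Pattern.hexagonParallel]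
    grind [G.adj_comm]
  · refine Or.inl ⟨[[f], [a], [b], [c], [d], [e]], rfl, ?_, by simp [isConn_singleton], ?_⟩
    · simp at hnd ⊢
      grind
    · simp [Pattern.hexagonCrossing]
      grind [G.adj_comm]

theorem k5_isMinor {a b c d e : V} (hnd : [a, b, c, d, e].Nodup)
    (h : ∀ u ∈ [a, b, c, d, e], ∀ v ∈ [a, b, c, d, e], u ≠ v → G.Adj u v) :
    Pattern.k5.IsMinor G := by
  refine ⟨[[a], [b], [c], [d], [e]], rfl, by simpa using hnd, by simp [isConn_singleton], ?_⟩
  simp [Pattern.k5] at hnd h ⊢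
  grind

theorem exists_eq_of_length_four {l : List V} (h : l.length = 4) : ∃ a b c d, l = [a, b, c, d] := by
  rcases l with _ | ⟨a, _ | ⟨b, _ | ⟨c, _ | ⟨d, _ | ⟨e, l⟩⟩⟩⟩⟩ <;> simp at h ⊢

theorem exists_eq_of_length_five {l : List V} (h : l.length = 5) :
    ∃ a b c d e, l = [a, b, c, d, e] := by
  rcases l with _ | ⟨a, l⟩
  · simp at h
  · obtain ⟨b, c, d, e, rfl⟩ := exists_eq_of_length_four (l := l) (by simpa using h)
    exact ⟨a, b, c, d, e, rfl⟩

theorem exists_eq_of_length_six {l : List V} (h : l.length = 6) :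
    ∃ a b c d e f, l = [a, b, c, d, e, f] := by
  rcases l with _ | ⟨a, l⟩
  · simp at h
  · obtain ⟨b, c, d, e, f, rfl⟩ := exists_eq_of_length_five (l := l) (by simpa using h)
    exact ⟨a, b, c, d, e, f, rfl⟩

/-- A graph on five vertices is complete or two of its vertices are not adjacent. -/
theorem isSpanningSubgraphOf_K5MinusEdge_or_isMinor {l : List V} (hl : l.length = 5) (hnd : l.Nodup)
    (hcov : ∀ v, v ∈ l) : IsSpanningSubgraphOf G K5MinusEdge ∨ Pattern.k5.IsMinor G := by
  by_cases h : ∀ u ∈ l, ∀ v ∈ l, u ≠ v → G.Adj u v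
  · obtain ⟨a, b, c, d, e, rfl⟩ := exists_eq_of_length_five hl
    exact Or.inr (k5_isMinor hnd h)
  · push Not at h
    obtain ⟨u, hu, v, hv, huv, hadj⟩ := h
    obtain ⟨s, t, rfl⟩ := List.append_of_mem hu
    have hv' : v ∈ s ++ t := by
      simp only [List.mem_append, List.mem_cons] at hv ⊢
      tauto
    obtain ⟨s', t', hst⟩ := List.append_of_mem hv'
    have hperm : (u :: v :: (s' ++ t')).Perm (s ++ u :: t) := by
      have : (u :: (s ++ t)).Perm (s ++ u :: t) := List.perm_middle.symm
      rw [hst] at this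
      exact (List.Perm.cons u List.perm_middle.symm).trans this
    have hlen := hperm.length_eq
    rw [hl] at hlen
    obtain ⟨a, b, c, d, e, habc⟩ := exists_eq_of_length_five hlen
    obtain ⟨rfl, h'⟩ := List.cons.inj habc
    obtain ⟨rfl, -⟩ := List.cons.inj h'
    rw [habc] at hperm
    exact Or.inl (isSpanningSubgraphOf_K5MinusEdge (hperm.nodup_iff.2 hnd)
      (fun x => hperm.mem_iff.2 (hcov x)) hadj)

/-- A longest cycle of length at least five is Hamiltonian if three colours cannot be saved. In
length at least seven every chord saves a third colour; in length six all chords join three alternate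
vertices of the cycle. -/
theorem isTwoConnectedExtremal_of_five_le [Finite V] (hE : G.IsEdgeConnected 2) (hG : G.Connected)
    (hS : ¬ SavesThree G) {l : List V} (hl : IsCyc G l)
    (hmax : ∀ l', IsCyc G l' → l'.length ≤ l.length) (h5 : 5 ≤ l.length) :
    IsTwoConnectedExtremal G := by
  have hcov : ∀ v, v ∈ l := by
    by_contra! h
    obtain ⟨v, hv⟩ := h
    rcases saves_of_notMem_longest_cyc hE hl hmax h5 hv with h | h
    · exact hS (h.savesThree Pattern.isValid_theta223 hG rfl (by decide))
    · exact hS (h.savesThree Pattern.isValid_pentagonTriangle hG rfl (by decide))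
  have hlong : ∀ a b s t, IsCyc G (a :: (s ++ b :: t)) → G.Adj a b → 2 ≤ s.length →
      2 ≤ t.length → False := fun a b s t h hab hs ht =>
    hS ((theta133_isMinor h hab hs ht).savesThree Pattern.isValid_theta133 hG rfl (by decide))
  have hshort : ∀ a b s t, IsCyc G (a :: (s ++ b :: t)) → G.Adj a b → s.length = 1 →
      4 ≤ t.length → False := by
    intro a b s t h hab hs ht
    obtain ⟨c, rfl⟩ := List.length_eq_one_iff.1 hs
    exact hS ((theta125_isMinor h hab ht).savesThree Pattern.isValid_theta125 hG rfl (by decide))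
  refine ⟨isTwoConnected_of_isCyc hl hcov, ?_⟩
  rcases lt_or_ge l.length 7 with h7 | h7
  · obtain h | h : l.length = 5 ∨ l.length = 6 := by omega
    · rcases isSpanningSubgraphOf_K5MinusEdge_or_isMinor (G := G) h hl.2.1 hcov with h | h
      · exact Or.inr (Or.inr (Or.inl h))
      · exact absurd (h.savesThree Pattern.isValid_k5 hG rfl (by decide)) hS
    · obtain ⟨a, b, c, d, e, f, rfl⟩ := exists_eq_of_length_six h
      have hhex : ∀ {a b c d e f : V}, IsCyc G [a, b, c, d, e, f] → G.Adj a c →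
          ¬ G.Adj b d ∧ ¬ G.Adj d f ∧ ¬ G.Adj f b := by
        intro a b c d e f h hac
        by_contra hn
        rcases hexagon_isMinor_of_adj h hac (by tauto) with h | h
        · exact hS (h.savesThree Pattern.isValid_hexagonCrossing hG rfl (by decide))
        · exact hS (h.savesThree Pattern.isValid_hexagonParallel hG rfl (by decide))
      have h1 : IsCyc G [b, c, d, e, f, a] := IsCyc.rotate (s := [a]) hl
      have h2 : IsCyc G [c, d, e, f, a, b] := IsCyc.rotate (s := [b]) h1
      have h3 : IsCyc G [d, e, f, a, b, c] := IsCyc.rotate (s := [c]) h2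
      have h4 : IsCyc G [e, f, a, b, c, d] := IsCyc.rotate (s := [d]) h3
      have l1 : ¬ G.Adj a d := fun h => hlong a d [b, c] [e, f] hl h le_rfl le_rfl
      have l2 : ¬ G.Adj b e := fun h => hlong b e [c, d] [f, a] h1 h le_rfl le_rfl
      have l3 : ¬ G.Adj c f := fun h => hlong c f [d, e] [a, b] h2 h le_rfl le_rfl
      refine Or.inr (Or.inl ?_)
      by_cases hodd : G.Adj a c ∨ G.Adj c e ∨ G.Adj e a
      · have : ¬ G.Adj b d ∧ ¬ G.Adj d f ∧ ¬ G.Adj f b := by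
          rcases hodd with h | h | h
          · exact hhex hl h
          · have := hhex h2 h
            tauto
          · have := hhex h4 h
            tauto
        exact isSpanningSubgraphOf_threeSun h1.2.1
          (by simpa [or_assoc, or_comm, or_left_comm] using hcov) this.1
          (fun h => this.2.2 h.symm) this.2.1 l2 l3 (fun h => l1 h.symm)
      · push Not at hodd
        exact isSpanningSubgraphOf_threeSun hl.2.1 hcov hodd.1 (fun h => hodd.2.2 h.symm)
          hodd.2.1 l1 l2 l3
  · refine Or.inl (iso_cycleGraph_of_chordless hl hcov fun a b s t h hlen hab => ?_)
    have h' : IsCyc G (b :: (t ++ a :: s)) := by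
      simpa using IsCyc.rotate (s := a :: s) (t := b :: t) (by simpa using h)
    by_contra! hn
    have p1 := List.length_pos_iff.2 hn.1
    have p2 := List.length_pos_iff.2 hn.2
    simp only [List.length_cons, List.length_append] at hlen
    by_cases q1 : s.length = 1
    · exact hshort a b s t h hab q1 (by omega)
    · by_cases q2 : t.length = 1
      · exact hshort b a t s h' hab.symm q2 (by omega)
      · exact hlong a b s t h hab (by omega) (by omega)

/-! ### Ears as branch sets -/

theorem IsEar.isConn {A : List V} {a b : V} {p : List V} (h : IsEar G A a b p) : IsConn G p :=
  isConn_of_isChain_ends h.chain h.ne_nil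

theorem IsEar.exists_adj {A : List V} {a b : V} {p : List V} (h : IsEar G A a b p) :
    (∃ x ∈ p, G.Adj a x) ∧ ∃ x ∈ p, G.Adj b x :=
  exists_adj_of_isChain_ends h.chain h.ne_nil

theorem IsEar.nodup_append {A : List V} {a b : V} {p l : List V} (h : IsEar G A a b p)
    (hl : l.Nodup) (hA : ∀ v ∈ l, v ∈ A) : (l ++ p).Nodup := by
  refine List.nodup_append.2 ⟨hl, h.nodup, ?_⟩
  rintro z hz w hw rfl
  exact h.disjoint z hw (hA z hz)

/-- A closed ear contracts to a triangle. -/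
theorem IsEar.exists_split {A : List V} {a : V} {p : List V} (h : IsEar G A a a p) :
    ∃ y q, p = y :: q ∧ q ≠ [] ∧ IsConn G q ∧ G.Adj a y ∧ (∃ z ∈ q, G.Adj y z) ∧
      ∃ z ∈ q, G.Adj a z := by
  have h2 := h.two_le rfl
  have h3 := h.chain
  rcases p with _ | ⟨y, q⟩
  · simp at h2
  · have hq : q ≠ [] := by
      rintro rfl
      simp at h2
    rw [List.cons_append, List.isChain_cons_cons] at h3
    exact ⟨y, q, rfl, hq, isConn_of_isChain_ends h3.2 hq, h3.1,
      exists_adj_of_isChain_ends h3.2 hq⟩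

/-! ### Ears of `K_{2,3}` -/

/-- `K_{2,3}` with the parts `a c` and `b d x`. -/
structure IsK23 (G : SimpleGraph V) (a c b d x : V) : Prop where
  nodup : [a, c, b, d, x].Nodup
  adj : ∀ u ∈ [a, c], ∀ v ∈ [b, d, x], G.Adj u v

theorem IsK23.swap {a c b d x : V} (h : IsK23 G a c b d x) : IsK23 G c a b d x := by
  obtain ⟨h1, h2⟩ := h
  refine ⟨?_, ?_⟩
  · simp at h1 ⊢
    grind
  · simp at h2 ⊢
    grind

theorem IsK23.perm {a c b d x b' d' x' : V} (h : IsK23 G a c b d x)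
    (hp : [b', d', x'].Perm [b, d, x]) : IsK23 G a c b' d' x' :=
  ⟨(((hp.cons c).cons a).nodup_iff).2 h.nodup,
    fun u hu v hv => h.adj u hu v (hp.mem_iff.1 hv)⟩

section Ears

variable {A p : List V} {a b c d x y : V}

theorem IsK23.k24_isMinor (h : IsK23 G a c b d x) (hA : ∀ v ∈ [a, c, b, d, x], v ∈ A)
    (hp : IsEar G A a c p) : Pattern.k24.IsMinor G := by
  obtain ⟨h1, h2⟩ := h
  have e := hp.exists_adj
  refine ⟨[[a], [c], [b], [d], [x], p], rfl, ?_, by simp [isConn_singleton, hp.isConn], ?_⟩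
  · have hd := hp.disjoint
    have hn := hp.nodup
    simp at h1 hA ⊢
    grind
  · simp [Pattern.k24] at e h2 ⊢
    grind

theorem IsK23.theta223_isMinor (h : IsK23 G a c b d x) (hA : ∀ v ∈ [a, c, b, d, x], v ∈ A)
    (hp : IsEar G A a b p) : Pattern.theta223.IsMinor G := by
  obtain ⟨h1, h2⟩ := h
  have e := hp.exists_adj
  refine ⟨[[a], [d], [c], [x], p, [b]], rfl, ?_, by simp [isConn_singleton, hp.isConn], ?_⟩
  · have hd := hp.disjoint
    have hn := hp.nodup
    simp [List.nodup_append] at h1 hA ⊢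
    grind
  · simp [Pattern.theta223] at e h2 ⊢
    grind [G.adj_comm]

theorem IsK23.theta133_isMinor (h : IsK23 G a c b d x) (hA : ∀ v ∈ [a, c, b, d, x], v ∈ A)
    (hp : IsEar G A b d p) : Pattern.theta133.IsMinor G := by
  obtain ⟨h1, h2⟩ := h
  have e := hp.exists_adj
  refine ⟨[[a], [x], [c], [b], p, [d]], rfl, ?_, by simp [isConn_singleton, hp.isConn], ?_⟩
  · have hd := hp.disjoint
    have hn := hp.nodup
    simp [List.nodup_append] at h1 hA ⊢
    grind
  · simp [Pattern.theta133] at e h2 ⊢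
    grind [G.adj_comm]

theorem IsK23.k23TriangleAtThree_isMinor (h : IsK23 G a c b d x)
    (hA : ∀ v ∈ [a, c, b, d, x], v ∈ A) (hp : IsEar G A a a p) :
    Pattern.k23TriangleAtThree.IsMinor G := by
  obtain ⟨h1, h2⟩ := h
  obtain ⟨y, q, rfl, -, hq, e1, e2, e3⟩ := hp.exists_split
  refine ⟨[[a], [c], [b], [d], [x], [y], q], rfl, ?_, by simp [isConn_singleton, hq], ?_⟩
  · have hd := hp.disjoint
    have hn := hp.nodup
    simp at h1 hA hn hd ⊢
    grind
  · simp [Pattern.k23TriangleAtThree] at e2 e3 h2 ⊢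
    grind

theorem IsK23.k23TriangleAtTwo_isMinor (h : IsK23 G a c b d x)
    (hA : ∀ v ∈ [a, c, b, d, x], v ∈ A) (hp : IsEar G A b b p) :
    Pattern.k23TriangleAtTwo.IsMinor G := by
  obtain ⟨h1, h2⟩ := h
  obtain ⟨y, q, rfl, -, hq, e1, e2, e3⟩ := hp.exists_split
  refine ⟨[[a], [c], [b], [d], [x], [y], q], rfl, ?_, by simp [isConn_singleton, hq], ?_⟩
  · have hd := hp.disjoint
    have hn := hp.nodup
    simp at h1 hA hn hd ⊢
    grind
  · simp [Pattern.k23TriangleAtTwo] at e2 e3 h2 ⊢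
    grind

/-- Every ear of a `K_{2,3}` saves a third colour. -/
theorem IsK23.savesThree_of_isEar [Finite V] (hG : G.Connected) (h : IsK23 G a c b d x) {u v : V}
    (hp : IsEar G [a, c, b, d, x] u v p) : SavesThree G := by
  -- the symmetries of `K_{2,3}` leave five kinds of ears
  have same : ∀ a c b d x, IsK23 G a c b d x → ∀ A p, (∀ v ∈ [a, c, b, d, x], v ∈ A) →
      (IsEar G A a c p ∨ IsEar G A a b p ∨ IsEar G A b a p ∨ IsEar G A b d p ∨ IsEar G A a a p ∨
        IsEar G A b b p) → SavesThree G := by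
    intro a c b d x h A p hA hp
    rcases hp with hp | hp | hp | hp | hp | hp
    · exact (h.k24_isMinor hA hp).savesThree Pattern.isValid_k24 hG rfl (by decide)
    · exact (h.theta223_isMinor hA hp).savesThree Pattern.isValid_theta223 hG rfl (by decide)
    · exact (h.theta223_isMinor hA hp.reverse).savesThree Pattern.isValid_theta223 hG rfl
        (by decide)
    · exact (h.theta133_isMinor hA hp).savesThree Pattern.isValid_theta133 hG rfl (by decide)
    · exact (h.k23TriangleAtThree_isMinor hA hp).savesThree Pattern.isValid_k23TriangleAtThree hG
        rfl (by decide)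
    · exact (h.k23TriangleAtTwo_isMinor hA hp).savesThree Pattern.isValid_k23TriangleAtTwo hG
        rfl (by decide)
  -- normalize first the part of three vertices, then the part of two
  have hperm : ∀ u' ∈ [b, d, x], ∀ v' ∈ [b, d, x], u' ≠ v' →
      ∃ w', [u', v', w'].Perm [b, d, x] := by
    have h3 : [b, d, x].Nodup := h.nodup.of_cons.of_cons
    intro u' hu' v' hv' huv'
    obtain ⟨w', hw'⟩ : ∃ w', ([b, d, x] : List V).Perm [u', v', w'] := by
      simp only [List.mem_cons, List.not_mem_nil, or_false] at hu' hv'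
      rcases hu' with rfl | rfl | rfl <;> rcases hv' with rfl | rfl | rfl
      · exact absurd rfl huv'
      · exact ⟨x, .refl _⟩
      · exact ⟨d, (List.Perm.swap _ _ _).cons _⟩
      · exact ⟨x, List.Perm.swap _ _ _⟩
      · exact absurd rfl huv'
      · exact ⟨b, (List.Perm.swap _ _ _).trans ((List.Perm.swap _ _ _).cons _)⟩
      · exact ⟨d, ((List.Perm.swap _ _ _).cons _).trans (List.Perm.swap _ _ _)⟩
      · exact ⟨b, (((List.Perm.swap _ _ _).cons _).trans (List.Perm.swap _ _ _)).trans
          ((List.Perm.swap _ _ _).cons _)⟩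
      · exact absurd rfl huv'
    exact ⟨w', hw'.symm⟩
  have hperm1 : ∀ u' ∈ [b, d, x], ∃ v' w', [u', v', w'].Perm [b, d, x] := by
    intro u' hu'
    obtain ⟨v', hv', hne⟩ : ∃ v' ∈ [b, d, x], u' ≠ v' := by
      have := h.nodup
      simp at this hu' ⊢
      grind
    exact ⟨v', hperm u' hu' v' hv' hne⟩
  have hpart : ∀ w ∈ [a, c, b, d, x], w ∈ [a, c] ∨ w ∈ [b, d, x] := by
    intro w hw
    simp at hw ⊢
    tauto
  have htwo : ∀ w ∈ [a, c], ∃ w', IsK23 G w w' b d x ∧ (∀ z ∈ [w, w', b, d, x], z ∈ [a, c, b, d, x])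
      ∧ ∀ z ∈ [a, c], z = w ∨ z = w' := by
    intro w hw
    simp only [List.mem_cons, List.not_mem_nil, or_false] at hw
    rcases hw with rfl | rfl
    · exact ⟨c, h, fun z hz => hz, by simp⟩
    · refine ⟨a, h.swap, fun z hz => (List.Perm.swap _ _ _).mem_iff.1 hz, fun z hz => ?_⟩
      exact Or.symm (by simpa using hz)
  have hsub : ∀ {a' c' b' d' x' : V}, (∀ z ∈ [a', c', b, d, x], z ∈ [a, c, b, d, x]) →
      [b', d', x'].Perm [b, d, x] → ∀ z ∈ [a', c', b', d', x'], z ∈ [a, c, b, d, x] := by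
    intro a' c' b' d' x' h1 h2 z hz
    exact h1 z ((((h2.cons c').cons a').mem_iff).1 hz)
  rcases hpart u hp.left_mem with hu | hu
  · obtain ⟨u', k1, k2, k3⟩ := htwo u hu
    rcases hpart v hp.right_mem with hv | hv
    · rcases k3 v hv with rfl | rfl
      · exact same _ _ _ _ _ k1 _ p k2 (by tauto)
      · exact same _ _ _ _ _ k1 _ p k2 (by tauto)
    · obtain ⟨y, z, k4⟩ := hperm1 v hv
      exact same _ _ _ _ _ (k1.perm k4) _ p (hsub k2 k4) (by tauto)
  · rcases hpart v hp.right_mem with hv | hv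
    · obtain ⟨v', k1, k2, k3⟩ := htwo v hv
      obtain ⟨y, z, k4⟩ := hperm1 u hu
      exact same _ _ _ _ _ (k1.perm k4) _ p (hsub k2 k4) (by tauto)
    · by_cases huv : u = v
      · subst huv
        obtain ⟨y, z, k4⟩ := hperm1 u hu
        exact same _ _ _ _ _ (h.perm k4) _ p (hsub (fun z hz => hz) k4) (by tauto)
      · obtain ⟨w, k4⟩ := hperm u hu v hv huv
        exact same _ _ _ _ _ (h.perm k4) _ p (hsub (fun z hz => hz) k4) (by tauto)

/-! ### Ears of a 4-cycle with a triangle -/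

/-- A 4-cycle `a b c d` and a triangle `a x y`. -/
structure IsSquareTriangle (G : SimpleGraph V) (a b c d x y : V) : Prop where
  nodup : [a, b, c, d, x, y].Nodup
  ab : G.Adj a b
  bc : G.Adj b c
  cd : G.Adj c d
  da : G.Adj d a
  ax : G.Adj a x
  ay : G.Adj a y
  xy : G.Adj x y

theorem IsSquareTriangle.swap_square (h : IsSquareTriangle G a b c d x y) :
    IsSquareTriangle G a d c b x y :=
  ⟨by have := h.nodup; simp at this ⊢; grind, h.da.symm, h.cd.symm, h.bc.symm, h.ab.symm, h.ax,
    h.ay, h.xy⟩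

theorem IsSquareTriangle.swap_triangle (h : IsSquareTriangle G a b c d x y) :
    IsSquareTriangle G a b c d y x :=
  ⟨by have := h.nodup; simp at this ⊢; grind, h.ab, h.bc, h.cd, h.da, h.ay, h.ax, h.xy.symm⟩

/-- Every ear of a 4-cycle with a triangle saves a third colour. The ears from the vertices `d` and
`y` are symmetric to those listed here. -/
theorem IsSquareTriangle.savesThree_of_isEar_aux [Finite V] (hG : G.Connected)
    (h : IsSquareTriangle G a b c d x y) (hA : ∀ v ∈ [a, b, c, d, x, y], v ∈ A)
    (hp : IsEar G A a x p ∨ IsEar G A x y p ∨ IsEar G A a b p ∨ IsEar G A b c p ∨ IsEar G A a c p ∨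
      IsEar G A b d p ∨ IsEar G A x b p ∨ IsEar G A x c p ∨ IsEar G A a a p ∨ IsEar G A b b p ∨
      IsEar G A c c p ∨ IsEar G A x x p) : SavesThree G := by
  obtain ⟨h1, hab, hbc, hcd, hda, hax, hay, hxy⟩ := h
  have hcd' : IsConn G [c, d] := isConn_of_isChain (by simp) (by simpa using hcd)
  have hab' : IsConn G [a, b] := isConn_of_isChain (by simp) (by simpa using hab)
  have facts : ∀ u v, IsEar G A u v p → ((∃ x ∈ p, G.Adj u x) ∧ ∃ x ∈ p, G.Adj v x) ∧
      (p ++ [a, b, c, d, x, y]).Nodup := fun u v hp =>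
    ⟨hp.exists_adj, List.nodup_append_comm.1 (hp.nodup_append h1 hA)⟩
  rcases hp with hp | hp | hp | hp | hp | hp | hp | hp | hp | hp | hp | hp
  · obtain ⟨e, hn⟩ := facts _ _ hp
    have : Pattern.twoSquares.IsMinor G := by
      refine ⟨[[a], [b], [c], [d], p, [x], [y]], rfl, ?_, by simp [isConn_singleton, hp.isConn], ?_⟩
      · simp [List.nodup_append] at hn ⊢
        grind
      · simp [Pattern.twoSquares] at e ⊢
        grind [G.adj_comm]
    exact this.savesThree Pattern.isValid_twoSquares hG rfl (by decide)
  · obtain ⟨e, hn⟩ := facts _ _ hp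
    have : Pattern.twoSquares.IsMinor G := by
      refine ⟨[[a], [b], [c], [d], [x], p, [y]], rfl, ?_, by simp [isConn_singleton, hp.isConn], ?_⟩
      · simp [List.nodup_append] at hn ⊢
        grind
      · simp [Pattern.twoSquares] at e ⊢
        grind [G.adj_comm]
    exact this.savesThree Pattern.isValid_twoSquares hG rfl (by decide)
  · obtain ⟨e, hn⟩ := facts _ _ hp
    have : Pattern.pentagonTriangle.IsMinor G := by
      refine ⟨[[a], p, [b], [c], [d], [x], [y]], rfl, ?_, by simp [isConn_singleton, hp.isConn], ?_⟩
      · simp [List.nodup_append] at hn ⊢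
        grind
      · simp [Pattern.pentagonTriangle] at e ⊢
        grind [G.adj_comm]
    exact this.savesThree Pattern.isValid_pentagonTriangle hG rfl (by decide)
  · obtain ⟨e, hn⟩ := facts _ _ hp
    have : Pattern.pentagonTriangle.IsMinor G := by
      refine ⟨[[a], [b], p, [c], [d], [x], [y]], rfl, ?_, by simp [isConn_singleton, hp.isConn], ?_⟩
      · simp [List.nodup_append] at hn ⊢
        grind
      · simp [Pattern.pentagonTriangle] at e ⊢
        grind [G.adj_comm]
    exact this.savesThree Pattern.isValid_pentagonTriangle hG rfl (by decide)
  · obtain ⟨e, hn⟩ := facts _ _ hp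
    have : Pattern.k23TriangleAtThree.IsMinor G := by
      refine ⟨[[a], [c], [b], [d], p, [x], [y]], rfl, ?_, by simp [isConn_singleton, hp.isConn], ?_⟩
      · simp [List.nodup_append] at hn ⊢
        grind
      · simp [Pattern.k23TriangleAtThree] at e ⊢
        grind [G.adj_comm]
    exact this.savesThree Pattern.isValid_k23TriangleAtThree hG rfl (by decide)
  · obtain ⟨e, hn⟩ := facts _ _ hp
    have : Pattern.k23TriangleAtTwo.IsMinor G := by
      refine ⟨[[b], [d], [a], [c], p, [x], [y]], rfl, ?_, by simp [isConn_singleton, hp.isConn], ?_⟩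
      · simp [List.nodup_append] at hn ⊢
        grind
      · simp [Pattern.k23TriangleAtTwo] at e ⊢
        grind [G.adj_comm]
    exact this.savesThree Pattern.isValid_k23TriangleAtTwo hG rfl (by decide)
  · obtain ⟨e, hn⟩ := facts _ _ hp
    have : Pattern.theta125.IsMinor G := by
      refine ⟨[[a], [y], [x], p, [b], [c], [d]], rfl, ?_, by simp [isConn_singleton, hp.isConn], ?_⟩
      · simp [List.nodup_append] at hn ⊢
        grind
      · simp [Pattern.theta125] at e ⊢
        grind [G.adj_comm]
    exact this.savesThree Pattern.isValid_theta125 hG rfl (by decide)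
  · obtain ⟨e, hn⟩ := facts _ _ hp
    have : Pattern.theta223.IsMinor G := by
      refine ⟨[[a], [b], [c], [d], [x], p], rfl, ?_, by simp [isConn_singleton, hp.isConn], ?_⟩
      · simp [List.nodup_append] at hn ⊢
        grind
      · simp [Pattern.theta223] at e ⊢
        grind [G.adj_comm]
    exact this.savesThree Pattern.isValid_theta223 hG rfl (by decide)
  · obtain ⟨-, hn⟩ := facts _ _ hp
    obtain ⟨z, q, rfl, -, hq, e1, e2, e3⟩ := hp.exists_split
    have : Pattern.threeTriangles.IsMinor G := by
      refine ⟨[[a], [b], [c, d], [x], [y], [z], q], rfl, ?_,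
        by simp [isConn_singleton, hq, hcd'], ?_⟩
      · simp [List.nodup_append] at hn ⊢
        grind
      · simp [Pattern.threeTriangles] at e2 e3 ⊢
        grind [G.adj_comm]
    exact this.savesThree Pattern.isValid_threeTriangles hG rfl (by decide)
  · obtain ⟨-, hn⟩ := facts _ _ hp
    obtain ⟨z, q, rfl, -, hq, e1, e2, e3⟩ := hp.exists_split
    have : Pattern.threeTriangles.IsMinor G := by
      refine ⟨[[a, b], [c], [d], [x], [y], [z], q], rfl, ?_,
        by simp [isConn_singleton, hq, hab'], ?_⟩
      · simp [List.nodup_append] at hn ⊢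
        grind
      · simp [Pattern.threeTriangles] at e2 e3 ⊢
        grind [G.adj_comm]
    exact this.savesThree Pattern.isValid_threeTriangles hG rfl (by decide)
  · obtain ⟨-, hn⟩ := facts _ _ hp
    obtain ⟨z, q, rfl, -, hq, e1, e2, e3⟩ := hp.exists_split
    have : Pattern.squareOppositeTriangles.IsMinor G := by
      refine ⟨[[a], [b], [c], [d], [x], [y], [z], q], rfl, ?_, by simp [isConn_singleton, hq], ?_⟩
      · simp [List.nodup_append] at hn ⊢
        grind
      · simp [Pattern.squareOppositeTriangles] at e2 e3 ⊢
        grind [G.adj_comm]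
    exact this.savesThree Pattern.isValid_squareOppositeTriangles hG rfl (by decide)
  · obtain ⟨-, hn⟩ := facts _ _ hp
    obtain ⟨z, q, rfl, -, hq, e1, e2, e3⟩ := hp.exists_split
    have : Pattern.squareTriangleTriangle.IsMinor G := by
      refine ⟨[[a], [b], [c], [d], [x], [y], [z], q], rfl, ?_, by simp [isConn_singleton, hq], ?_⟩
      · simp [List.nodup_append] at hn ⊢
        grind
      · simp [Pattern.squareTriangleTriangle] at e2 e3 ⊢
        grind [G.adj_comm]
    exact this.savesThree Pattern.isValid_squareTriangleTriangle hG rfl (by decide)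

theorem IsSquareTriangle.savesThree_of_isEar [Finite V] (hG : G.Connected)
    (h : IsSquareTriangle G a b c d x y) {u v : V} (hp : IsEar G [a, b, c, d, x, y] u v p) :
    SavesThree G := by
  have hl := hp.left_mem
  have hr := hp.right_mem
  have m1 : ∀ v ∈ [a, b, c, d, x, y], v ∈ [a, b, c, d, x, y] := fun _ h => h
  have m2 : ∀ v ∈ [a, d, c, b, x, y], v ∈ [a, b, c, d, x, y] := by simp
  have m3 : ∀ v ∈ [a, b, c, d, y, x], v ∈ [a, b, c, d, x, y] := by simp
  have m4 : ∀ v ∈ [a, d, c, b, y, x], v ∈ [a, b, c, d, x, y] := by simp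
  have k1 := fun p => h.savesThree_of_isEar_aux (A := [a, b, c, d, x, y]) (p := p) hG m1
  have k2 := fun p => h.swap_square.savesThree_of_isEar_aux (A := [a, b, c, d, x, y]) (p := p) hG m2
  have k3 := fun p =>
    h.swap_triangle.savesThree_of_isEar_aux (A := [a, b, c, d, x, y]) (p := p) hG m3
  have k4 := fun p =>
    h.swap_square.swap_triangle.savesThree_of_isEar_aux (A := [a, b, c, d, x, y]) (p := p) hG m4
  have hp' := hp.reverse
  simp only [List.mem_cons, List.not_mem_nil, or_false] at hl hr
  rcases hl with rfl | rfl | rfl | rfl | rfl | rfl <;>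
    rcases hr with rfl | rfl | rfl | rfl | rfl | rfl <;>
    first
    | exact k1 p (by simp only [hp, true_or, or_true])
    | exact k2 p (by simp only [hp, true_or, or_true])
    | exact k3 p (by simp only [hp, true_or, or_true])
    | exact k4 p (by simp only [hp, true_or, or_true])
    | exact k1 p.reverse (by simp only [hp', true_or, or_true])
    | exact k2 p.reverse (by simp only [hp', true_or, or_true])
    | exact k3 p.reverse (by simp only [hp', true_or, or_true])
    | exact k4 p.reverse (by simp only [hp', true_or, or_true])

end Ears

/-! ### Graphs whose longest cycles have length four -/

theorem IsK23.isTwoConnected [Finite V] {a c b d x : V} (h : IsK23 G a c b d x)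
    (hcov : ∀ v, v ∈ [a, c, b, d, x]) : IsTwoConnected G := by
  obtain ⟨hnd, hadj⟩ := h
  have hcard : Nat.card V = 5 := card_eq_length hnd hcov
  have hconn : ∀ s : Set V, (∃ u ∈ [a, c], u ∈ s) → (∃ v ∈ [b, d, x], v ∈ s) →
      (G.induce s).Connected := by
    rintro s ⟨u, hu, hus⟩ ⟨v, hv, hvs⟩
    have huv : (G.induce s).Adj ⟨u, hus⟩ ⟨v, hvs⟩ := hadj u hu v hv
    have key : ∀ w : s, (G.induce s).Reachable ⟨u, hus⟩ w := by
      rintro ⟨w, hw⟩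
      have : w ∈ [a, c] ∨ w ∈ [b, d, x] := by
        have := hcov w
        simp only [List.mem_cons, List.not_mem_nil, or_false] at this ⊢
        tauto
      rcases this with h | h
      · have hwv : (G.induce s).Adj ⟨w, hw⟩ ⟨v, hvs⟩ := hadj w h v hv
        exact huv.reachable.trans hwv.reachable.symm
      · have huw : (G.induce s).Adj ⟨u, hus⟩ ⟨w, hw⟩ := hadj u hu w h
        exact huw.reachable
    exact (connected_iff_exists_forall_reachable _).2 ⟨⟨u, hus⟩, key⟩
  refine ⟨by omega, (induceUnivIso G).connected_iff.1 (hconn _ ⟨a, by simp⟩ ⟨b, by simp⟩),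
    fun v => hconn _ ?_ ?_⟩
  · simp at hnd ⊢
    grind
  · simp at hnd ⊢
    grind

theorem isSpanningSubgraphOf_completeGraph [Finite V] (h : Nat.card V = 4) :
    IsSpanningSubgraphOf G (completeGraph (Fin 4)) := by
  have e := (Finite.equivFin V).trans (finCongr h)
  exact ⟨e, fun u v huv => by simpa using huv.ne⟩

/-- As no cycle has length five or more, chords of a 4-cycle with a triangle stay in the 4-cycle. -/
theorem IsSquareTriangle.isCutVertexExtremal {a b c d x y : V}
    (h : IsSquareTriangle G a b c d x y) (hcov : ∀ v, v ∈ [a, b, c, d, x, y])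
    (hmax : ∀ l, IsCyc G l → l.length ≤ 4) (hk4 : ¬ (G.Adj a c ∧ G.Adj b d)) :
    IsCutVertexExtremal G := by
  have hcross : ∀ {a b c d x y : V}, IsSquareTriangle G a b c d x y →
      ¬ G.Adj b x ∧ ¬ G.Adj c x := by
    intro a b c d x y h
    obtain ⟨hnd, hab, hbc, hcd, hda, hax, hay, hxy⟩ := h
    constructor
    · intro hbx
      have := hmax [a, y, x, b, c, d] (isCyc_cons.2 ⟨by simp, by simp at hnd ⊢; grind, by
        simp <;> grind [G.adj_comm]⟩)
      simp at this
    · intro hcx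
      have := hmax [a, y, x, c, b] (isCyc_cons.2 ⟨by simp, by simp at hnd ⊢; grind, by
        simp <;> grind [G.adj_comm]⟩)
      simp at this
  obtain ⟨n1, n2⟩ := hcross h
  obtain ⟨n3, n4⟩ := hcross h.swap_triangle
  obtain ⟨n5, -⟩ := hcross h.swap_square
  obtain ⟨n6, -⟩ := hcross h.swap_square.swap_triangle
  obtain ⟨hnd, hab, hbc, hcd, hda, hax, hay, hxy⟩ := h
  have hw : Function.Bijective ![b, c, d, a, x, y] :=
    bijective_of_nodup (by simp at hnd ⊢; grind) (by simpa [or_left_comm] using hcov)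
  by_cases hac : G.Adj a c
  · have hbd : ¬ G.Adj b d := fun hbd => hk4 ⟨hac, hbd⟩
    refine Or.inr (Or.inr (Or.inr (Or.inl (nonempty_iso_of_bijective hw fun i j => ?_))))
    fin_cases i <;> fin_cases j <;> first
      | (refine iff_of_true ?_ (by unfold F4; decide); simp <;> grind [G.adj_comm])
      | (refine iff_of_false ?_ (by unfold F4; decide); simp <;> grind [G.adj_comm])
  · by_cases hbd : G.Adj b d
    · refine Or.inr (Or.inr (Or.inl (nonempty_iso_of_bijective hw fun i j => ?_)))
      fin_cases i <;> fin_cases j <;> first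
        | (refine iff_of_true ?_ (by unfold F3; decide); simp <;> grind [G.adj_comm])
        | (refine iff_of_false ?_ (by unfold F3; decide); simp <;> grind [G.adj_comm])
    · refine Or.inr (Or.inl (nonempty_iso_of_bijective hw fun i j => ?_))
      fin_cases i <;> fin_cases j <;> first
        | (refine iff_of_true ?_ (by unfold F2; decide); simp <;> grind [G.adj_comm])
        | (refine iff_of_false ?_ (by unfold F2; decide); simp <;> grind [G.adj_comm])

theorem IsSquareTriangle.k4Triangle_isMinor {a b c d x y : V}
    (h : IsSquareTriangle G a b c d x y) (hac : G.Adj a c) (hbd : G.Adj b d) :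
    Pattern.k4Triangle.IsMinor G := by
  obtain ⟨hnd, hab, hbc, hcd, hda, hax, hay, hxy⟩ := h
  refine ⟨[[a], [b], [c], [d], [x], [y]], rfl, by simpa using hnd, by simp [isConn_singleton], ?_⟩
  simp [Pattern.k4Triangle]
  grind [G.adj_comm]

theorem twoSquares_isMinor {A : List V} {a b c d x y z : V} (h : IsCyc G [a, b, c, d])
    (hA : ∀ v ∈ [a, b, c, d], v ∈ A) (hp : IsEar G A a a [x, y, z]) :
    Pattern.twoSquares.IsMinor G := by
  obtain ⟨-, h2, h3⟩ := isCyc_cons.1 h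
  have h4 := hp.chain
  refine ⟨[[a], [b], [c], [d], [x], [y], [z]], rfl, hp.nodup_append h2 hA,
    by simp [isConn_singleton], ?_⟩
  · simp at h3 h4
    simp [Pattern.twoSquares]
    grind [G.adj_comm]

/-- An ear of a 4-cycle that misses a vertex produces a `K_{2,3}`, a 4-cycle with a triangle or two
4-cycles with a common vertex. The latter save a third colour, and so does a further ear of the
others. -/
theorem extremal_of_eq_four [Finite V] (hE : G.IsEdgeConnected 2) (hG : G.Connected)
    (hS : ¬ SavesThree G) {l : List V} (hl : IsCyc G l)
    (hmax : ∀ l', IsCyc G l' → l'.length ≤ l.length) (h4 : l.length = 4) :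
    IsTwoConnectedExtremal G ∨ IsCutVertexExtremal G := by
  by_cases hcov : ∀ v, v ∈ l
  · refine Or.inl ⟨isTwoConnected_of_isCyc hl hcov, Or.inr (Or.inr (Or.inr ?_))⟩
    exact isSpanningSubgraphOf_completeGraph ((card_eq_length hl.2.1 hcov).trans h4)
  push Not at hcov
  obtain ⟨v, hv⟩ := hcov
  obtain ⟨r, hr⟩ : ∃ r, r ∈ l := ⟨l[0], List.getElem_mem _⟩
  obtain ⟨u, w, p, hp⟩ := exists_isEar hE hr hv
  have hp1 := List.length_pos_iff.2 hp.ne_nil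
  by_cases huw : u = w
  · subst huw
    obtain ⟨t, h1, h2⟩ := hl.exists_perm_cons hp.left_mem
    obtain ⟨a, b, c, d, h3⟩ := exists_eq_of_length_four (h2.length_eq.trans h4)
    obtain ⟨rfl, rfl⟩ := List.cons.inj h3
    have hA : ∀ z ∈ [u, b, c, d], z ∈ l := fun z hz => h2.mem_iff.1 hz
    have hcyc : IsCyc G (u :: p) := isCyc_cons.2 ⟨hp.two_le rfl,
      List.nodup_cons.2 ⟨fun h => hp.disjoint u h hp.left_mem, hp.nodup⟩, hp.chain⟩
    have hlen := hmax _ hcyc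
    have hlen2 := hp.two_le rfl
    rw [h4, List.length_cons] at hlen
    obtain h | h : p.length = 2 ∨ p.length = 3 := by omega
    · obtain ⟨x, y, rfl⟩ := List.length_eq_two.1 h
      have hsq : IsSquareTriangle G u b c d x y := by
        have c1 := (isCyc_cons.1 h1).2.2
        have c2 := hp.chain
        have hnd := h1.2.1
        have hd := hp.disjoint
        have hn := hp.nodup
        simp at c1 c2
        refine ⟨?_, c1.1, c1.2.1, c1.2.2.1, c1.2.2.2, c2.1, c2.2.2.symm, c2.2.1⟩
        simp at hnd hA hd hn ⊢
        grind
      by_cases hcov' : ∀ v, v ∈ [u, b, c, d, x, y]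
      · refine Or.inr (hsq.isCutVertexExtremal hcov' (fun l hl => h4 ▸ hmax l hl) ?_)
        rintro ⟨hac, hbd⟩
        exact hS ((hsq.k4Triangle_isMinor hac hbd).savesThree Pattern.isValid_k4Triangle hG rfl
          (by decide))
      · push Not at hcov'
        obtain ⟨v', hv'⟩ := hcov'
        obtain ⟨u', w', p', hp'⟩ := exists_isEar hE (List.mem_cons_self (a := u)) hv'
        exact absurd (hsq.savesThree_of_isEar hG hp') hS
    · obtain ⟨x, y, z, rfl⟩ := List.length_eq_three.1 h
      exact absurd ((twoSquares_isMinor h1 hA hp).savesThree Pattern.isValid_twoSquares hG rfl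
        (by decide)) hS
  · obtain ⟨s, t, h1, h2⟩ := hl.exists_perm_cons_append_cons hp.left_mem hp.right_mem huw
    have hA : ∀ x ∈ u :: (s ++ w :: t), x ∈ l := fun x hx => h2.mem_iff.1 hx
    have h1' : IsCyc G (w :: (t ++ u :: s)) := by
      simpa using IsCyc.rotate (s := u :: s) (t := w :: t) (by simpa using h1)
    have hA' : ∀ x ∈ w :: (t ++ u :: s), x ∈ l := fun x hx => hA x (by
      simp only [List.mem_cons, List.mem_append] at hx ⊢
      tauto)
    have hlen := h2.length_eq
    have m1 := hmax _ (h1.replace hp hA)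
    have m2 := hmax _ (h1'.replace hp.reverse hA')
    simp only [List.length_cons, List.length_append, List.length_reverse] at hlen m1 m2
    -- a longest cycle cannot be rerouted through the ear, so both arcs and the ear have one vertex
    obtain ⟨b, rfl⟩ := List.length_eq_one_iff.1 (show s.length = 1 by omega)
    obtain ⟨d, rfl⟩ := List.length_eq_one_iff.1 (show t.length = 1 by omega)
    obtain ⟨x, rfl⟩ := List.length_eq_one_iff.1 (show p.length = 1 by omega)
    have hK : IsK23 G u w b d x := by
      have c1 := (isCyc_cons.1 h1).2.2
      have c2 := hp.chain
      have hnd := h1.2.1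
      have hd := hp.disjoint
      constructor
      · simp at hnd hA hd ⊢
        grind
      · simp at c1 c2 ⊢
        grind [G.adj_comm]
    by_cases hcov' : ∀ v, v ∈ [u, w, b, d, x]
    · refine Or.inl ⟨hK.isTwoConnected hcov', Or.inr (Or.inr (Or.inl ?_))⟩
      rcases isSpanningSubgraphOf_K5MinusEdge_or_isMinor (G := G) rfl hK.nodup hcov' with h | h
      · exact h
      · exact absurd (h.savesThree Pattern.isValid_k5 hG rfl (by decide)) hS
    · push Not at hcov'
      obtain ⟨v', hv'⟩ := hcov'
      obtain ⟨u', w', p', hp'⟩ := exists_isEar hE (List.mem_cons_self (a := u)) hv'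
      exact absurd (hK.savesThree_of_isEar hG hp') hS

/-! ### Graphs whose cycles are triangles -/

/-- Any two distinct vertices of `A` are joined by a path in `A` with at least one inner vertex. -/
def IsLinked (G : SimpleGraph V) (A : List V) : Prop :=
  ∀ u ∈ A, ∀ w ∈ A, u ≠ w → ∃ s, s ≠ [] ∧ (u :: (s ++ [w])).IsChain G.Adj ∧
    (u :: (s ++ [w])).Nodup ∧ ∀ z ∈ s, z ∈ A

theorem isLinked_singleton (a : V) : IsLinked G [a] := by
  intro u hu w hw huw
  rw [List.mem_singleton] at hu hw
  exact absurd (hu.trans hw.symm) huw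

/-- A triangle `u x y` that meets `A` in `u`. -/
structure IsPendantTriangle (G : SimpleGraph V) (A : List V) (u x y : V) : Prop where
  mem : u ∈ A
  left_notMem : x ∉ A
  right_notMem : y ∉ A
  ux : G.Adj u x
  uy : G.Adj u y
  xy : G.Adj x y

theorem IsPendantTriangle.symm {A : List V} {u x y : V} (h : IsPendantTriangle G A u x y) :
    IsPendantTriangle G A u y x :=
  ⟨h.mem, h.right_notMem, h.left_notMem, h.uy, h.ux, h.xy.symm⟩

theorem IsLinked.append {A : List V} {u x y : V} (hA : IsLinked G A)
    (h : IsPendantTriangle G A u x y) : IsLinked G (A ++ [x, y]) := by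
  have hrev : ∀ v w, (∃ s, s ≠ [] ∧ (v :: (s ++ [w])).IsChain G.Adj ∧ (v :: (s ++ [w])).Nodup ∧
      ∀ z ∈ s, z ∈ A ++ [x, y]) → ∃ s, s ≠ [] ∧ (w :: (s ++ [v])).IsChain G.Adj ∧
      (w :: (s ++ [v])).Nodup ∧ ∀ z ∈ s, z ∈ A ++ [x, y] := by
    rintro v w ⟨s, h1, h2, h3, h4⟩
    refine ⟨s.reverse, by simpa using h1, isChain_reverse_ends h2, ?_, by simpa using h4⟩
    simpa using List.nodup_reverse.2 h3
  have hout : ∀ {x' y'}, IsPendantTriangle G A u x' y' → (∀ z, z ∈ A ∨ z = y' → z ∈ A ++ [x, y]) →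
      ∀ w ∈ A, ∃ s, s ≠ [] ∧ (x' :: (s ++ [w])).IsChain G.Adj ∧ (x' :: (s ++ [w])).Nodup ∧
      ∀ z ∈ s, z ∈ A ++ [x, y] := by
    intro x' y' h' hsub w hw
    by_cases huw : u = w
    · subst huw
      refine ⟨[y'], by simp, by simp [h'.xy, h'.uy.symm], ?_, by simpa using hsub y' (Or.inr rfl)⟩
      simp [h'.xy.ne, h'.ux.ne.symm, h'.uy.ne.symm]
    · obtain ⟨s, h1, h2, h3, h4⟩ := hA u h'.mem w hw huw
      refine ⟨u :: s, by simp, List.isChain_cons_cons.2 ⟨h'.ux.symm, h2⟩, ?_, ?_⟩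
      · refine List.nodup_cons.2 ⟨fun hx => h'.left_notMem ?_, h3⟩
        simp only [List.cons_append, List.mem_cons, List.mem_append, List.not_mem_nil,
          or_false] at hx
        rcases hx with rfl | hx | rfl
        exacts [h'.mem, h4 _ hx, hw]
      · intro z hz
        rcases List.mem_cons.1 hz with rfl | hz
        exacts [hsub _ (Or.inl h'.mem), hsub _ (Or.inl (h4 _ hz))]
  have hx := hout h (fun z hz => by simp; tauto)
  have hy := hout h.symm (fun z hz => by simp; tauto)
  have hxy : ∃ s, s ≠ [] ∧ (x :: (s ++ [y])).IsChain G.Adj ∧ (x :: (s ++ [y])).Nodup ∧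
      ∀ z ∈ s, z ∈ A ++ [x, y] :=
    ⟨[u], by simp, by simp [h.ux.symm, h.uy], by
      simp [h.ux.ne.symm, h.uy.ne, h.xy.ne], by simp [h.mem]⟩
  intro v hv w hw hvw
  simp only [List.mem_append, List.mem_cons, List.not_mem_nil, or_false] at hv hw
  rcases hv with hv | rfl | rfl <;> rcases hw with hw | rfl | rfl
  · obtain ⟨s, h1, h2, h3, h4⟩ := hA v hv w hw hvw
    exact ⟨s, h1, h2, h3, fun z hz => List.mem_append_left _ (h4 z hz)⟩
  · exact hrev _ _ (hx v hv)
  · exact hrev _ _ (hy v hv)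
  · exact hx w hw
  · exact absurd rfl hvw
  · exact hxy
  · exact hy w hw
  · exact hrev _ _ hxy
  · exact absurd rfl hvw

theorem IsPendantTriangle.not_adj {A : List V} {u x y : V} (h : IsPendantTriangle G A u x y)
    (hA : IsLinked G A) (hmax : ∀ l, IsCyc G l → l.length ≤ 3) {w : V} (hw : w ∈ A) (huw : w ≠ u) :
    ¬ G.Adj w x ∧ ¬ G.Adj w y := by
  have key : ∀ {x y : V}, IsPendantTriangle G A u x y → ¬ G.Adj w x := by
    intro x y h hwx
    obtain ⟨s, h1, h2, h3, h4⟩ := hA u h.mem w hw huw.symm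
    have hs := List.length_pos_iff.2 h1
    have := hmax (x :: (u :: (s ++ [w]))) (isCyc_cons.2 ⟨by simp, ?_, ?_⟩)
    · simp only [List.length_cons, List.length_append, List.length_nil] at this
      omega
    · refine List.nodup_cons.2 ⟨fun hx => h.left_notMem ?_, h3⟩
      simp only [List.mem_cons, List.mem_append, List.not_mem_nil, or_false] at hx
      rcases hx with rfl | hx | rfl
      exacts [h.mem, h4 _ hx, hw]
    · have : (u :: (s ++ w :: [x])).IsChain G.Adj :=
        isChain_cons_append_cons.2 ⟨h2, by simpa using hwx⟩
      rw [List.cons_append, List.append_assoc, List.isChain_cons_cons]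
      exact ⟨h.ux.symm, this⟩
  exact ⟨key h, key h.symm⟩

theorem IsEar.isPendantTriangle {A p : List V} {u w : V} (h : IsEar G A u w p) (hA : IsLinked G A)
    (hmax : ∀ l, IsCyc G l → l.length ≤ 3) :
    ∃ x y, p = [x, y] ∧ IsPendantTriangle G A u x y := by
  have hp := List.length_pos_iff.2 h.ne_nil
  by_cases huw : u = w
  · subst huw
    have hcyc : IsCyc G (u :: p) := isCyc_cons.2 ⟨h.two_le rfl,
      List.nodup_cons.2 ⟨fun hu => h.disjoint u hu h.left_mem, h.nodup⟩, h.chain⟩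
    have h1 := hmax _ hcyc
    have h2 := h.two_le rfl
    rw [List.length_cons] at h1
    obtain ⟨x, y, rfl⟩ := List.length_eq_two.1 (show p.length = 2 by omega)
    have hc := h.chain
    simp at hc
    exact ⟨x, y, rfl, h.left_mem, h.disjoint x (by simp), h.disjoint y (by simp), hc.1, hc.2.2.symm,
      hc.2.1⟩
  · obtain ⟨s, h1, h2, h3, h4⟩ := hA u h.left_mem w h.right_mem huw
    have hs := List.length_pos_iff.2 h1
    have := hmax (u :: (s ++ w :: p.reverse)) (isCyc_cons_append_cons.2 ⟨by omega, ?_, h2,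
      isChain_reverse_ends h.chain⟩)
    · simp only [List.length_cons, List.length_append, List.length_reverse] at this
      omega
    · have hd := h.disjoint
      have hn := h.nodup
      have hl := h.left_mem
      have hr := h.right_mem
      simp [List.nodup_append] at h3 ⊢
      grind

section Triangles

variable {A : List V} {a b c x y p q : V}

theorem threeTriangles_isMinor (hnd : [a, b, c, x, y, p, q].Nodup) (hab : G.Adj a b)
    (hac : G.Adj a c) (hbc : G.Adj b c) (hax : G.Adj a x) (hay : G.Adj a y) (hxy : G.Adj x y)
    (hap : G.Adj a p) (haq : G.Adj a q) (hpq : G.Adj p q) : Pattern.threeTriangles.IsMinor G := by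
  refine ⟨[[a], [b], [c], [x], [y], [p], [q]], rfl, by simpa using hnd, by simp [isConn_singleton],
    ?_⟩
  simp [Pattern.threeTriangles, *]

/-- The triangles `a b c` and `a x y`. -/
structure IsBowtie (G : SimpleGraph V) (a b c x y : V) : Prop where
  nodup : [a, b, c, x, y].Nodup
  ab : G.Adj a b
  ac : G.Adj a c
  bc : G.Adj b c
  ax : G.Adj a x
  ay : G.Adj a y
  xy : G.Adj x y

theorem IsBowtie.swap_left (h : IsBowtie G a b c x y) : IsBowtie G a c b x y :=
  ⟨by have := h.nodup; simp at this ⊢; grind, h.ac, h.ab, h.bc.symm, h.ax, h.ay, h.xy⟩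

theorem IsBowtie.swap (h : IsBowtie G a b c x y) : IsBowtie G a x y b c :=
  ⟨by have := h.nodup; simp at this ⊢; grind, h.ax, h.ay, h.xy, h.ab, h.ac, h.bc⟩

theorem IsBowtie.isMinor (h : IsBowtie G a b c x y) : Pattern.bowtie.IsMinor G := by
  obtain ⟨hnd, hab, hac, hbc, hax, hay, hxy⟩ := h
  refine ⟨[[a], [b], [c], [x], [y]], rfl, by simpa using hnd, by simp [isConn_singleton], ?_⟩
  simp [Pattern.bowtie, *]

/-- The chain of the triangles `x y a`, `a c b` and `b p q`. -/
structure IsTriangleChain (G : SimpleGraph V) (x y a c b p q : V) : Prop where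
  nodup : [x, y, a, c, b, p, q].Nodup
  xy : G.Adj x y
  xa : G.Adj x a
  ya : G.Adj y a
  ac : G.Adj a c
  ab : G.Adj a b
  cb : G.Adj c b
  bp : G.Adj b p
  bq : G.Adj b q
  pq : G.Adj p q

set_option maxHeartbeats 800000 in
theorem IsTriangleChain.nonempty_iso (h : IsTriangleChain G x y a c b p q)
    (hcov : ∀ v, v ∈ [x, y, a, c, b, p, q])
    (h1 : ¬ G.Adj b x ∧ ¬ G.Adj b y ∧ ¬ G.Adj c x ∧ ¬ G.Adj c y)
    (h2 : ¬ G.Adj a p ∧ ¬ G.Adj a q ∧ ¬ G.Adj c p ∧ ¬ G.Adj c q)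
    (h3 : ¬ G.Adj x p ∧ ¬ G.Adj x q ∧ ¬ G.Adj y p ∧ ¬ G.Adj y q) : Nonempty (G ≃g F5) := by
  obtain ⟨hnd, hxy, hxa, hya, hac, hab, hcb, hbp, hbq, hpq⟩ := h
  refine nonempty_iso_of_bijective (w := ![x, y, a, c, b, p, q])
    (bijective_of_nodup (by simpa using hnd) (by simpa using hcov)) fun i j => ?_
  clear hnd hcov
  fin_cases i <;> fin_cases j <;> first
    | (refine iff_of_true ?_ (by unfold F5; decide); simp <;> grind [G.adj_comm])
    | (refine iff_of_false ?_ (by unfold F5; decide); simp <;> grind [G.adj_comm])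

theorem IsTriangleChain.reverse (h : IsTriangleChain G x y a c b p q) :
    IsTriangleChain G q p b c a y x :=
  ⟨by have := h.nodup; simp at this ⊢; grind, h.pq.symm, h.bq.symm, h.bp.symm, h.cb.symm,
    h.ab.symm, h.ac.symm, h.ya.symm, h.xa.symm, h.xy.symm⟩

theorem IsTriangleChain.swap (h : IsTriangleChain G x y a c b p q) :
    IsTriangleChain G y x a c b p q :=
  ⟨by have := h.nodup; simp at this ⊢; grind, h.xy.symm, h.ya, h.xa, h.ac, h.ab, h.cb, h.bp, h.bq,
    h.pq⟩

/-- Every triangle attached to a chain of three triangles saves a third colour. The positions on the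
far side of the middle triangle are symmetric to those listed here. -/
theorem IsTriangleChain.savesThree_aux [Finite V] (hG : G.Connected) {r s t : V}
    (h : IsTriangleChain G x y a c b p q) (hA : ∀ v ∈ [x, y, a, c, b, p, q], v ∈ A)
    (ht : IsPendantTriangle G A t r s) (htt : t = x ∨ t = a ∨ t = c) : SavesThree G := by
  obtain ⟨hnd, hxy, hxa, hya, hac, hab, hcb, hbp, hbq, hpq⟩ := h
  obtain ⟨-, hr, hs, htr, hts, hrs⟩ := ht
  have hnd' : [r, s, x, y, a, c, b, p, q].Nodup := by
    refine List.nodup_cons.2 ⟨?_, List.nodup_cons.2 ⟨fun h => hs (hA _ h), hnd⟩⟩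
    intro h
    rcases List.mem_cons.1 h with h | h
    exacts [hrs.ne h, hr (hA _ h)]
  rcases htt with rfl | rfl | rfl
  · have : Pattern.triangleChain.IsMinor G := by
      refine ⟨[[r], [s], [t], [y], [a], [c], [b], [p], [q]], rfl, by simpa using hnd',
        by simp [isConn_singleton], ?_⟩
      simp [Pattern.triangleChain, G.adj_comm, *]
      grind [G.adj_comm]
    exact this.savesThree Pattern.isValid_triangleChain hG rfl (by decide)
  · have : Pattern.threeTriangles.IsMinor G :=
      threeTriangles_isMinor (b := x) (c := y) (x := c) (y := b) (p := r) (q := s)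
        (by simp at hnd' ⊢; grind) hxa.symm hya.symm hxy hac hab hcb htr hts hrs
    exact this.savesThree Pattern.isValid_threeTriangles hG rfl (by decide)
  · have : Pattern.triangleStar.IsMinor G := by
      refine ⟨[[a], [b], [t], [x], [y], [p], [q], [r], [s]], rfl, by simp at hnd' ⊢; grind,
        by simp [isConn_singleton], ?_⟩
      simp [Pattern.triangleStar]
      grind [G.adj_comm]
    exact this.savesThree Pattern.isValid_triangleStar hG rfl (by decide)

theorem IsTriangleChain.savesThree [Finite V] (hG : G.Connected) {r s t : V}
    (h : IsTriangleChain G x y a c b p q) (hA : ∀ v, v ∈ A ↔ v ∈ [x, y, a, c, b, p, q])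
    (ht : IsPendantTriangle G A t r s) : SavesThree G := by
  have hm := (hA t).1 ht.mem
  simp only [List.mem_cons, List.not_mem_nil, or_false] at hm
  have hA' : ∀ v, v ∈ [x, y, a, c, b, p, q] → v ∈ A := fun v hv => (hA v).2 hv
  rcases hm with hm | hm | hm | hm | hm | hm | hm
  · exact h.savesThree_aux hG hA' ht (by simp [hm])
  · exact h.swap.savesThree_aux hG
      (fun v hv => hA' v ((List.Perm.swap _ _ _).mem_iff.1 hv)) ht (by simp [hm])
  · exact h.savesThree_aux hG hA' ht (by simp [hm])
  · exact h.savesThree_aux hG hA' ht (by simp [hm])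
  · exact h.reverse.savesThree_aux hG
      (fun v hv => hA' v (by simpa using List.mem_reverse.2 hv)) ht (by simp [hm])
  · exact h.reverse.swap.savesThree_aux hG (fun v hv => hA' v (by
      simpa using List.mem_reverse.2 ((List.Perm.swap _ _ _).mem_iff.1 hv))) ht (by simp [hm])
  · exact h.reverse.savesThree_aux hG
      (fun v hv => hA' v (by simpa using List.mem_reverse.2 hv)) ht (by simp [hm])

/-- If every cycle is a triangle, then every ear is a triangle that hangs at one vertex. A third
triangle at the centre of a bowtie saves a third colour, so it hangs at another vertex and completes
a chain, to which no fourth triangle can be attached. -/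
theorem isCutVertexExtremal_of_bowtie [Finite V] (hE : G.IsEdgeConnected 2) (hG : G.Connected)
    (hS : ¬ SavesThree G) (hmax : ∀ l, IsCyc G l → l.length ≤ 3) (h : IsBowtie G a b c x y) :
    IsCutVertexExtremal G := by
  -- the sets spanned by the triangles that have been found so far
  have link : ∀ {a b c x y : V}, IsBowtie G a b c x y →
      IsPendantTriangle G [a] a b c ∧ IsPendantTriangle G [a, b, c] a x y ∧
      IsLinked G [a, b, c] ∧ IsLinked G [a, b, c, x, y] := by
    intro a b c x y h
    obtain ⟨hnd, hab, hac, hbc, hax, hay, hxy⟩ := h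
    have t1 : IsPendantTriangle G [a] a b c :=
      ⟨by simp, by simp [hab.ne.symm], by simp [hac.ne.symm], hab, hac, hbc⟩
    have t2 : IsPendantTriangle G [a, b, c] a x y :=
      ⟨by simp, by simp at hnd ⊢; grind, by simp at hnd ⊢; grind, hax, hay, hxy⟩
    have l1 : IsLinked G [a, b, c] := (isLinked_singleton a).append t1
    exact ⟨t1, t2, l1, l1.append t2⟩
  by_cases hcov : ∀ v, v ∈ [a, b, c, x, y]
  · obtain ⟨t1, t2, l1, l2⟩ := link h
    obtain ⟨n1, n2⟩ := t2.not_adj l1 hmax (w := b) (by simp) h.ab.ne.symm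
    obtain ⟨n3, n4⟩ := t2.not_adj l1 hmax (w := c) (by simp) h.ac.ne.symm
    obtain ⟨hnd, hab, hac, hbc, hax, hay, hxy⟩ := h
    have hw : Function.Bijective ![b, c, a, x, y] :=
      bijective_of_nodup (by simp at hnd ⊢; grind) (by simpa [or_left_comm] using hcov)
    refine Or.inl (nonempty_iso_of_bijective hw fun i j => ?_)
    fin_cases i <;> fin_cases j <;> first
      | (refine iff_of_true ?_ (by unfold F1; decide); simp <;> grind [G.adj_comm])
      | (refine iff_of_false ?_ (by unfold F1; decide); simp <;> grind [G.adj_comm])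
  · push Not at hcov
    obtain ⟨v, hv⟩ := hcov
    obtain ⟨u, w, l, hp⟩ := exists_isEar hE (List.mem_cons_self (a := a)) hv
    obtain ⟨p, q, rfl, ht⟩ := hp.isPendantTriangle (link h).2.2.2 hmax
    have main : ∀ {a b c x y : V}, IsBowtie G a b c x y →
        IsPendantTriangle G [a, b, c, x, y] b p q → IsCutVertexExtremal G := by
      intro a b c x y h ht
      obtain ⟨t1, t2, l1, l2⟩ := link h
      obtain ⟨n1, n2⟩ := t2.not_adj l1 hmax (w := b) (by simp) h.ab.ne.symm
      obtain ⟨n3, n4⟩ := t2.not_adj l1 hmax (w := c) (by simp) h.ac.ne.symm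
      obtain ⟨hnd, hab, hac, hbc, hax, hay, hxy⟩ := h
      have hne : a ≠ b ∧ c ≠ b ∧ x ≠ b ∧ y ≠ b := by
        simp at hnd
        grind
      obtain ⟨n5, n6⟩ := ht.not_adj l2 hmax (w := a) (by simp) hne.1
      obtain ⟨n7, n8⟩ := ht.not_adj l2 hmax (w := c) (by simp) hne.2.1
      obtain ⟨n9, n10⟩ := ht.not_adj l2 hmax (w := x) (by simp) hne.2.2.1
      obtain ⟨n11, n12⟩ := ht.not_adj l2 hmax (w := y) (by simp) hne.2.2.2
      have l3 : IsLinked G [a, b, c, x, y, p, q] := l2.append ht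
      obtain ⟨-, hp, hq, hbp, hbq, hpq⟩ := ht
      have hch : IsTriangleChain G x y a c b p q :=
        ⟨by have := hpq.ne; simp at hnd hp hq ⊢; grind, hxy, hax.symm, hay.symm, hac, hab, hbc.symm,
          hbp, hbq, hpq⟩
      by_cases hcov : ∀ v, v ∈ [x, y, a, c, b, p, q]
      · exact Or.inr (Or.inr (Or.inr (Or.inr (hch.nonempty_iso hcov
          ⟨n1, n2, n3, n4⟩ ⟨n5, n6, n7, n8⟩ ⟨n9, n10, n11, n12⟩))))
      · push Not at hcov
        obtain ⟨v, hv⟩ := hcov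
        have hA : ∀ v, v ∈ [a, b, c, x, y, p, q] ↔ v ∈ [x, y, a, c, b, p, q] := by
          intro v
          simp only [List.mem_cons, List.not_mem_nil, or_false]
          tauto
        obtain ⟨u', w', l', hp'⟩ := exists_isEar hE (List.mem_cons_self (a := a)) ((hA v).not.2 hv)
        obtain ⟨r, s, rfl, ht'⟩ := hp'.isPendantTriangle l3 hmax
        exact absurd (hch.savesThree hG hA ht') hS
    have hsub : ∀ A B : List V, (∀ v, v ∈ B → v ∈ A) → ∀ t, t ∈ B → IsPendantTriangle G A t p q →
        IsPendantTriangle G B t p q := fun A B hAB t ht h =>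
      ⟨ht, fun h' => h.left_notMem (hAB _ h'), fun h' => h.right_notMem (hAB _ h'), h.ux, h.uy,
        h.xy⟩
    have hm := ht.mem
    simp only [List.mem_cons, List.not_mem_nil, or_false] at hm
    rcases hm with rfl | rfl | rfl | rfl | rfl
    · obtain ⟨hnd, hab, hac, hbc, hax, hay, hxy⟩ := h
      obtain ⟨-, hp, hq, hbp, hbq, hpq⟩ := ht
      refine absurd ((threeTriangles_isMinor ?_ hab hac hbc hax hay hxy hbp hbq hpq).savesThree
        Pattern.isValid_threeTriangles hG rfl (by decide)) hS
      have := hpq.ne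
      simp at hnd hp hq ⊢
      grind
    · exact main h ht
    · exact main h.swap_left (hsub _ _ (by simp) _ (by simp) ht)
    · exact main h.swap (hsub _ _ (by simp) _ (by simp) ht)
    · exact main h.swap.swap_left (hsub _ _ (by simp) _ (by simp) ht)

theorem exists_isBowtie [Finite V] (hE : G.IsEdgeConnected 2) (hn : 4 ≤ Nat.card V) {l : List V}
    (hl : IsCyc G l) (hmax : ∀ l, IsCyc G l → l.length ≤ 3) :
    ∃ a b c x y, IsBowtie G a b c x y := by
  have hlen := hmax l hl
  have hlen' := hl.1
  obtain ⟨a, b, c, rfl⟩ := List.length_eq_three.1 (show l.length = 3 by omega)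
  obtain ⟨v, hv⟩ : ∃ v, v ∉ [a, b, c] := by
    by_contra! h
    have := card_eq_length hl.2.1 h
    simp only [List.length_cons, List.length_nil] at this
    omega
  have tri : ∀ {a b c : V}, IsCyc G [a, b, c] → [a, b, c].Nodup ∧ G.Adj a b ∧ G.Adj b c ∧
      G.Adj c a := by
    intro a b c h
    obtain ⟨-, h2, h3⟩ := isCyc_cons.1 h
    exact ⟨h2, by simpa using h3⟩
  obtain ⟨hnd, hab, hbc, hca⟩ := tri hl
  have hlink : IsLinked G [a, b, c] := (isLinked_singleton a).append
    ⟨by simp, by simp [hab.ne.symm], by simp [hca.ne], hab, hca.symm, hbc⟩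
  obtain ⟨u, w, p, hp⟩ := exists_isEar hE (List.mem_cons_self (a := a)) hv
  obtain ⟨x, y, rfl, ht⟩ := hp.isPendantTriangle hlink hmax
  obtain ⟨t, h1, h2⟩ := hl.exists_perm_cons ht.mem
  obtain ⟨a', b', c', h3⟩ := List.length_eq_three.1 (h2.length_eq)
  obtain ⟨rfl, rfl⟩ := List.cons.inj h3
  obtain ⟨hnd', hab', hbc', hca'⟩ := tri h1
  refine ⟨u, b', c', x, y, ?_, hab', hca'.symm, hbc', ht.ux, ht.uy, ht.xy⟩
  have h5 : ∀ v, v ∈ [u, b', c'] → v ∈ [a, b, c] := fun v hv => h2.mem_iff.1 hv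
  have h6 := ht.left_notMem
  have h7 := ht.right_notMem
  have h8 := ht.xy.ne
  have h9 : x ∉ [u, b', c'] := fun h => h6 (h5 _ h)
  have h10 : y ∉ [u, b', c'] := fun h => h7 (h5 _ h)
  simp at hnd' h9 h10 ⊢
  grind

end Triangles

/-! ### The upper bound and the graphs that attain it -/

theorem IsCyc.square_isMinor {l : List V} (h : IsCyc G l) (h4 : 4 ≤ l.length) :
    Pattern.square.IsMinor G := by
  match l, h4 with
  | a :: b :: c :: d :: t, _ =>
    obtain ⟨-, hnd, hch⟩ := isCyc_cons.1 h
    have hcon : IsConn G (d :: t) := by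
      refine isConn_of_isChain (by simp) ?_
      simp only [List.cons_append, List.isChain_cons_cons] at hch
      rw [← List.cons_append] at hch
      exact (List.isChain_append.1 hch.2.2.2).1
    obtain ⟨u, hu, hua⟩ : ∃ u ∈ d :: t, G.Adj u a := by
      simp only [List.cons_append, List.isChain_cons_cons] at hch
      rw [← List.cons_append] at hch
      obtain ⟨u, hu, v, hv, huv⟩ := exists_adj_of_isChain_append hch.2.2.2 (by simp) (by simp)
      obtain rfl := List.mem_singleton.1 hv
      exact ⟨u, hu, huv⟩
    simp only [List.cons_append, List.isChain_cons_cons] at hch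
    refine ⟨[[a], [b], [c], d :: t], rfl, by simpa using hnd, by simp [isConn_singleton, hcon], ?_⟩
    have : ∃ v ∈ d :: t, G.Adj a v := ⟨u, hu, hua.symm⟩
    simp [Pattern.square] at this ⊢
    exact ⟨hch.1, hch.2.1, Or.inl hch.2.2.1, this⟩

theorem rx_add_two_le [Finite V] (hE : G.IsEdgeConnected 2) (hG : G.Connected)
    (hn : 4 ≤ Nat.card V) : rx 3 G + 2 ≤ Nat.card V := by
  have : Nontrivial V := (Finite.one_lt_card_iff_nontrivial).1 (by omega)
  obtain ⟨l, hl, hmax⟩ := exists_longest_cyc (exists_isCyc hE)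
  by_cases h4 : 4 ≤ l.length
  · have := (hl.square_isMinor h4).rx_le Pattern.isValid_square hG (by decide) (by decide)
    simp only [Pattern.square] at this
    omega
  · obtain ⟨a, b, c, x, y, h⟩ := exists_isBowtie hE hn hl fun l' hl' => by
      have := hmax l' hl'
      omega
    have := h.isMinor.rx_le Pattern.isValid_bowtie hG (by decide) (by decide)
    simp only [Pattern.bowtie] at this
    omega

theorem extremal_of_not_savesThree [Finite V] (hE : G.IsEdgeConnected 2) (hG : G.Connected)
    (hn : 4 ≤ Nat.card V) (hS : ¬ SavesThree G) :
    IsTwoConnectedExtremal G ∨ IsCutVertexExtremal G := by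
  have : Nontrivial V := (Finite.one_lt_card_iff_nontrivial).1 (by omega)
  obtain ⟨l, hl, hmax⟩ := exists_longest_cyc (exists_isCyc hE)
  have h3 := hl.1
  obtain h | h | h : l.length = 3 ∨ l.length = 4 ∨ 5 ≤ l.length := by omega
  · rw [h] at hmax
    obtain ⟨a, b, c, x, y, hb⟩ := exists_isBowtie hE hn hl hmax
    exact Or.inr (isCutVertexExtremal_of_bowtie hE hG hS hmax hb)
  · exact extremal_of_eq_four hE hG hS hl hmax h
  · exact Or.inl (isTwoConnectedExtremal_of_five_le hE hG hS hl hmax h)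

/-! ### Rainbow trees and cuts -/

/-- The edges of a rainbow tree through `x`, `y` and `z` meet every cut that separates these
vertices. -/
theorem IsRainbowColoring.exists_edges {K : Type*} {c : G.EdgeLabeling K}
    (hc : IsRainbowColoring 3 c) {x y z : V} (hxy : x ≠ y) (hxz : x ≠ z) (hyz : y ≠ z) :
    ∃ F ⊆ G.edgeSet, (∀ e f : G.edgeSet, (e : Sym2 V) ∈ F → (f : Sym2 V) ∈ F → c e = c f → e = f) ∧
      ∀ X : Set V, ¬ ((x ∈ X ↔ y ∈ X) ∧ (x ∈ X ↔ z ∈ X)) → ∃ u ∈ X, ∃ v ∉ X, s(u, v) ∈ F := by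
  classical
  obtain ⟨T, ⟨hT, hrb⟩, hS⟩ := hc {x, y, z} (Finset.card_eq_three.2 ⟨x, y, z, hxy, hxz, hyz, rfl⟩)
  have hx : x ∈ T.verts := hS (by simp)
  have hy : y ∈ T.verts := hS (by simp)
  have hz : z ∈ T.verts := hS (by simp)
  refine ⟨T.edgeSet, T.edgeSet_subset, hrb, fun X hX => ?_⟩
  have key : ∀ a b : V, a ∈ T.verts → b ∈ T.verts → a ∈ X → b ∉ X →
      ∃ u ∈ X, ∃ v ∉ X, s(u, v) ∈ T.edgeSet := by
    intro a b ha hb haX hbX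
    obtain ⟨u, hu, v, hv, huv⟩ := exists_adj_of_mem_of_notMem (G := T.coe)
      (S := {w | (w : V) ∈ X}) (hT.connected.preconnected ⟨a, ha⟩ ⟨b, hb⟩) haX hbX
    exact ⟨u, hu, v, hv, huv⟩
  by_cases h1 : x ∈ X <;> by_cases h2 : y ∈ X <;> by_cases h3 : z ∈ X
  · exact absurd (by tauto) hX
  · exact key x z hx hz h1 h3
  · exact key x y hx hy h1 h2
  · exact key x y hx hy h1 h2
  · exact key y x hy hx h2 h1
  · exact key y x hy hx h2 h1
  · exact key z x hz hx h3 h1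
  · exact absurd (by tauto) hX

/-- The list of edges `B` meets every cut in the list `cuts` that separates `x`, `y` and `z`. -/
def Crosses {n : ℕ} (cuts : List (List (Fin n))) (x y z : Fin n) (B : List (Fin n × Fin n)) :
    Prop :=
  ∀ X ∈ cuts, ¬ ((x ∈ X ↔ y ∈ X) ∧ (x ∈ X ↔ z ∈ X)) → ∃ e ∈ B, ¬ (e.1 ∈ X ↔ e.2 ∈ X)

instance {n : ℕ} (cuts : List (List (Fin n))) (x y z : Fin n) (B : List (Fin n × Fin n)) :
    Decidable (Crosses cuts x y z B) := by
  unfold Crosses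
  infer_instance

/-- A rainbow colouring of a spanning subgraph of the graph with the edge list `E`, as a function on
the pairs in `E`. -/
theorem exists_col [Finite V] (hG : G.Connected) {n q : ℕ} (f : V ≃ Fin n)
    (E : List (Fin n × Fin n)) (hE : ∀ u v, G.Adj u v → (f u, f v) ∈ E ∨ (f v, f u) ∈ E)
    (hE' : E.Pairwise fun e e' => s(e.1, e.2) ≠ s(e'.1, e'.2)) (hq : rx 3 G ≤ q + 1) :
    ∃ col : Fin n × Fin n → Fin (q + 1), ∀ cuts, ∀ x y z : Fin n, x ≠ y → x ≠ z → y ≠ z →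
      ∃ B ∈ E.sublists, B.length ≤ q + 1 ∧ Crosses cuts x y z B ∧ (B.map col).Nodup := by
  classical
  obtain ⟨c, hc⟩ := exists_isRainbowColoring_rx 3 G hG
  let g : Fin n × Fin n → Sym2 V := fun e => s(f.symm e.1, f.symm e.2)
  let col : Fin n × Fin n → Fin (q + 1) := fun e =>
    if h : g e ∈ G.edgeSet then Fin.castLE hq (c ⟨g e, h⟩) else 0
  refine ⟨col, fun cuts x y z hxy hxz hyz => ?_⟩
  obtain ⟨F, hF, hrb, hcut⟩ := hc.exists_edges (f.symm.injective.ne hxy) (f.symm.injective.ne hxz)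
    (f.symm.injective.ne hyz)
  have hnd : ((E.filter fun e => g e ∈ F).map col).Nodup := by
    rw [List.Nodup, List.pairwise_map]
    refine (hE'.filter _).imp_of_mem fun {e e'} he he' hne heq => hne ?_
    have he : g e ∈ F := by simpa using (List.mem_filter.1 he).2
    have he' : g e' ∈ F := by simpa using (List.mem_filter.1 he').2
    simp only [col, dif_pos (hF he), dif_pos (hF he')] at heq
    have := congrArg Subtype.val (hrb ⟨_, hF he⟩ ⟨_, hF he'⟩ he he' (Fin.castLE_injective hq heq))
    have := congrArg (Sym2.map f) this
    simpa [g] using this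
  refine ⟨E.filter fun e => g e ∈ F, List.mem_sublists.2 List.filter_sublist, ?_, ?_, hnd⟩
  · simpa using hnd.length_le_card
  · intro X _ hX
    obtain ⟨u, hu, v, hv, huv⟩ := hcut {w | f w ∈ X} (by simpa using hX)
    have hu : f u ∈ X := hu
    have hv : f v ∉ X := hv
    rcases hE u v (hF huv) with h | h
    · exact ⟨_, List.mem_filter.2 ⟨h, by simpa [g] using huv⟩, by tauto⟩
    · exact ⟨_, List.mem_filter.2 ⟨h, by simpa [g, Sym2.eq_swap] using huv⟩, by tauto⟩

/-! ### Lower bounds for the small extremal graphs -/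

/-- If every small edge set that crosses the cuts separating `x`, `y` and `z` contains a member of
`trees`, then some member of `trees` is rainbow. -/
theorem exists_rainbow_of_crosses {n q : ℕ} {E : List (Fin n × Fin n)}
    {col : Fin n × Fin n → Fin (q + 1)} (cuts : List (List (Fin n))) {x y z : Fin n}
    (h : ∃ B ∈ E.sublists, B.length ≤ q + 1 ∧ Crosses cuts x y z B ∧ (B.map col).Nodup)
    (trees : List (List (Fin n × Fin n)))
    (ht : ∀ B ∈ E.sublists, B.length ≤ q + 1 → Crosses cuts x y z B →
      ∃ t ∈ trees, t.Nodup ∧ t ⊆ B) : ∃ t ∈ trees, (t.map col).Nodup := by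
  obtain ⟨B, h1, h2, h3, h4⟩ := h
  obtain ⟨t, h5, h6, h7⟩ := ht B h1 h2 h3
  exact ⟨t, h5, h6.map_on fun a ha b hb => List.inj_on_of_nodup_map h4 (h7 ha) (h7 hb)⟩

/-- One colour does not suffice, as a tree through three vertices has two edges. -/
theorem two_le_rx_of_completeGraph [Finite V] (hG : G.Connected)
    (h : IsSpanningSubgraphOf G (completeGraph (Fin 4))) : 2 ≤ rx 3 G := by
  obtain ⟨f, hf⟩ := h
  by_contra! hlt
  obtain ⟨col, hcol⟩ := exists_col (q := 0) hG f
    [(0, 1), (0, 2), (0, 3), (1, 2), (1, 3), (2, 3)]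
    (fun u v huv => by
      have := (hf u v huv)
      revert this
      generalize f u = a
      generalize f v = b
      revert a b
      decide) (by decide) (by omega)
  obtain ⟨t, ht, -⟩ := exists_rainbow_of_crosses _
    (hcol [[0], [1], [2]] 0 1 2 (by decide) (by decide) (by decide)) [] (by decide +kernel)
  simp at ht

set_option maxHeartbeats 800000 in
/-- With two colours a rainbow tree through three vertices is a path of length two. Hence the
colours of `0 w` and `1 w` differ for `w = 2, 3, 4`, and no triangle is monochromatic. -/
theorem three_le_rx_of_K5MinusEdge [Finite V] (hG : G.Connected)
    (h : IsSpanningSubgraphOf G K5MinusEdge) : 3 ≤ rx 3 G := by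
  obtain ⟨f, hf⟩ := h
  by_contra! hlt
  obtain ⟨col, hcol⟩ := exists_col (q := 1) hG f
    [(0, 2), (0, 3), (0, 4), (1, 2), (1, 3), (1, 4), (2, 3), (2, 4), (3, 4)]
    (fun u v huv => by
      have := (hf u v huv)
      revert this
      generalize f u = a
      generalize f v = b
      revert a b
      unfold K5MinusEdge
      simp only [deleteEdges_adj, top_adj, Set.mem_singleton_iff]
      decide) (by decide) (by omega)
  replace hcol := hcol [[0], [1], [2], [3], [4], [0, 2], [0, 3], [0, 4], [1, 2], [1, 3], [1, 4]]
  have h012 := exists_rainbow_of_crosses _ (hcol 0 1 2 (by decide) (by decide) (by decide))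
    [[(0, 2), (1, 2)]] (by decide +kernel)
  have h013 := exists_rainbow_of_crosses _ (hcol 0 1 3 (by decide) (by decide) (by decide))
    [[(0, 3), (1, 3)]] (by decide +kernel)
  have h014 := exists_rainbow_of_crosses _ (hcol 0 1 4 (by decide) (by decide) (by decide))
    [[(0, 4), (1, 4)]] (by decide +kernel)
  have h023 := exists_rainbow_of_crosses _ (hcol 0 2 3 (by decide) (by decide) (by decide))
    [[(0, 2), (0, 3)], [(0, 2), (2, 3)], [(0, 3), (2, 3)]] (by decide +kernel)
  have h024 := exists_rainbow_of_crosses _ (hcol 0 2 4 (by decide) (by decide) (by decide))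
    [[(0, 2), (0, 4)], [(0, 2), (2, 4)], [(0, 4), (2, 4)]] (by decide +kernel)
  have h034 := exists_rainbow_of_crosses _ (hcol 0 3 4 (by decide) (by decide) (by decide))
    [[(0, 3), (0, 4)], [(0, 3), (3, 4)], [(0, 4), (3, 4)]] (by decide +kernel)
  have h123 := exists_rainbow_of_crosses _ (hcol 1 2 3 (by decide) (by decide) (by decide))
    [[(1, 2), (1, 3)], [(1, 2), (2, 3)], [(1, 3), (2, 3)]] (by decide +kernel)
  have h124 := exists_rainbow_of_crosses _ (hcol 1 2 4 (by decide) (by decide) (by decide))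
    [[(1, 2), (1, 4)], [(1, 2), (2, 4)], [(1, 4), (2, 4)]] (by decide +kernel)
  have h134 := exists_rainbow_of_crosses _ (hcol 1 3 4 (by decide) (by decide) (by decide))
    [[(1, 3), (1, 4)], [(1, 3), (3, 4)], [(1, 4), (3, 4)]] (by decide +kernel)
  simp only [List.mem_cons, List.not_mem_nil, or_false, exists_eq_left, exists_eq_or_imp,
    List.map_cons, List.map_nil, List.nodup_cons, List.nodup_nil, not_false_eq_true, and_true]
    at h012 h013 h014 h023 h024 h034 h123 h124 h134
  generalize col (0, 2) = c02 at *
  generalize col (0, 3) = c03 at *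
  generalize col (0, 4) = c04 at *
  generalize col (1, 2) = c12 at *
  generalize col (1, 3) = c13 at *
  generalize col (1, 4) = c14 at *
  generalize col (2, 3) = c23 at *
  generalize col (2, 4) = c24 at *
  generalize col (3, 4) = c34 at *
  clear hcol hf
  revert c02 c03 c04 c12 c13 c14 c23 c24 c34
  decide +kernel

/-- No tree with three edges contains the three vertices of degree two. -/
theorem four_le_rx_of_threeSun [Finite V] (hG : G.Connected)
    (h : IsSpanningSubgraphOf G threeSun) : 4 ≤ rx 3 G := by
  obtain ⟨f, hf⟩ := h
  by_contra! hlt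
  obtain ⟨col, hcol⟩ := exists_col (q := 2) hG f
    [(0, 1), (1, 2), (2, 3), (3, 4), (4, 5), (5, 0), (1, 3), (1, 5), (3, 5)]
    (fun u v huv => by
      have := (hf u v huv)
      revert this
      generalize f u = a
      generalize f v = b
      revert a b
      unfold threeSun
      decide) (by decide) (by omega)
  obtain ⟨t, ht, -⟩ := exists_rainbow_of_crosses _
    (hcol [[0], [2], [4], [0, 1], [1, 2], [2, 3], [3, 4], [4, 5], [5, 0], [0, 1, 2], [1, 2, 3],
      [2, 3, 4]] 0 2 4 (by decide) (by decide) (by decide)) [] (by decide +kernel)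
  simp at ht

/-- No tree with three edges contains `1`, `4` and `5`. -/
theorem four_le_rx_of_F3 [Finite V] (hG : G.Connected)
    (h : IsSpanningSubgraphOf G F3) : 4 ≤ rx 3 G := by
  obtain ⟨f, hf⟩ := h
  by_contra! hlt
  obtain ⟨col, hcol⟩ := exists_col (q := 2) hG f
    [(0, 1), (1, 2), (2, 3), (3, 0), (3, 4), (4, 5), (5, 3), (0, 2)]
    (fun u v huv => by
      have := (hf u v huv)
      revert this
      generalize f u = a
      generalize f v = b
      revert a b
      unfold F3
      decide) (by decide) (by omega)
  obtain ⟨t, ht, -⟩ := exists_rainbow_of_crosses _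
    (hcol [[1], [4], [5], [4, 5], [0, 1], [1, 2], [0, 1, 2]]
      1 4 5 (by decide) (by decide) (by decide)) [] (by decide +kernel)
  simp at ht

/-- With three colours the edges `3 4` and `3 5` both get the colour that is missing on `0 3` and
`2 3`. Then `4 5` must have the colour of `2 3` and that of `0 3`. -/
theorem four_le_rx_of_F4 [Finite V] (hG : G.Connected)
    (h : IsSpanningSubgraphOf G F4) : 4 ≤ rx 3 G := by
  obtain ⟨f, hf⟩ := h
  by_contra! hlt
  obtain ⟨col, hcol⟩ := exists_col (q := 2) hG f
    [(0, 1), (1, 2), (2, 3), (3, 0), (3, 4), (4, 5), (5, 3), (1, 3)]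
    (fun u v huv => by
      have := (hf u v huv)
      revert this
      generalize f u = a
      generalize f v = b
      revert a b
      unfold F4
      decide) (by decide) (by omega)
  replace hcol := hcol [[0], [1], [2], [4], [5], [4, 5], [0, 1], [1, 2], [0, 1, 2]]
  have h024 := exists_rainbow_of_crosses _ (hcol 0 2 4 (by decide) (by decide) (by decide))
    [[(3, 0), (2, 3), (3, 4)]] (by decide +kernel)
  have h025 := exists_rainbow_of_crosses _ (hcol 0 2 5 (by decide) (by decide) (by decide))
    [[(3, 0), (2, 3), (5, 3)]] (by decide +kernel)
  have h045 := exists_rainbow_of_crosses _ (hcol 0 4 5 (by decide) (by decide) (by decide))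
    [[(3, 0), (3, 4), (5, 3)], [(3, 0), (3, 4), (4, 5)], [(3, 0), (4, 5), (5, 3)]]
    (by decide +kernel)
  have h245 := exists_rainbow_of_crosses _ (hcol 2 4 5 (by decide) (by decide) (by decide))
    [[(2, 3), (3, 4), (5, 3)], [(2, 3), (3, 4), (4, 5)], [(2, 3), (4, 5), (5, 3)]]
    (by decide +kernel)
  simp at h024 h025 h045 h245
  omega

/-- Some list of colours in `L` has no repetition. -/
def SomeNodup {K : Type*} (L : List (List K)) : Prop := ∃ l ∈ L, l.Nodup

instance {K : Type*} [DecidableEq K] (L : List (List K)) : Decidable (SomeNodup L) := by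
  unfold SomeNodup
  infer_instance

/-- The colours `p x y`, `u w m`, `z t s` of the edges of the three triangles of `F5`, in this order
along the chain, cannot satisfy the conditions given by ten triples of vertices. -/
theorem not_colorable_F5 : ∀ p x y m z : Fin 4,
    SomeNodup [[p, x, m, z], [p, y, m, z], [x, y, m, z]] → ∀ t : Fin 4,
    SomeNodup [[p, x, m, t], [p, y, m, t], [x, y, m, t]] → ∀ s : Fin 4,
    SomeNodup [[x, m, z, t], [x, m, z, s], [x, m, t, s]] →
    SomeNodup [[y, m, z, t], [y, m, z, s], [y, m, t, s]] → ∀ u w : Fin 4,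
    SomeNodup [[p, x, u], [p, y, u], [x, y, u], [p, x, m, w], [p, y, m, w], [x, y, m, w]] →
    SomeNodup [[w, z, t], [w, z, s], [w, t, s], [u, m, z, t], [u, m, z, s], [u, m, t, s]] →
    SomeNodup [[x, u, w, z], [x, u, m, z], [x, w, m, z]] →
    SomeNodup [[x, u, w, t], [x, u, m, t], [x, w, m, t]] →
    SomeNodup [[y, u, w, z], [y, u, m, z], [y, w, m, z]] →
    SomeNodup [[y, u, w, t], [y, u, m, t], [y, w, m, t]] → False := by
  decide +kernel

theorem five_le_rx_of_F5 [Finite V] (hG : G.Connected)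
    (h : IsSpanningSubgraphOf G F5) : 5 ≤ rx 3 G := by
  obtain ⟨f, hf⟩ := h
  by_contra! hlt
  obtain ⟨col, hcol⟩ := exists_col (q := 3) hG f
    [(0, 1), (0, 2), (1, 2), (2, 3), (3, 4), (2, 4), (4, 5), (4, 6), (5, 6)]
    (fun u v huv => by
      have := (hf u v huv)
      revert this
      generalize f u = a
      generalize f v = b
      revert a b
      unfold F5
      decide) (by decide) (by omega)
  replace hcol := hcol [[0], [1], [0, 1], [0, 1, 2], [3], [0, 1, 2, 3], [5], [6], [5, 6]]
  have h015 := exists_rainbow_of_crosses _ (hcol 0 1 5 (by decide) (by decide) (by decide))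
    [[(0, 1), (0, 2), (2, 4), (4, 5)], [(0, 1), (1, 2), (2, 4), (4, 5)],
      [(0, 2), (1, 2), (2, 4), (4, 5)]] (by decide +kernel)
  have h016 := exists_rainbow_of_crosses _ (hcol 0 1 6 (by decide) (by decide) (by decide))
    [[(0, 1), (0, 2), (2, 4), (4, 6)], [(0, 1), (1, 2), (2, 4), (4, 6)],
      [(0, 2), (1, 2), (2, 4), (4, 6)]] (by decide +kernel)
  have h056 := exists_rainbow_of_crosses _ (hcol 0 5 6 (by decide) (by decide) (by decide))
    [[(0, 2), (2, 4), (4, 5), (4, 6)], [(0, 2), (2, 4), (4, 5), (5, 6)],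
      [(0, 2), (2, 4), (4, 6), (5, 6)]] (by decide +kernel)
  have h156 := exists_rainbow_of_crosses _ (hcol 1 5 6 (by decide) (by decide) (by decide))
    [[(1, 2), (2, 4), (4, 5), (4, 6)], [(1, 2), (2, 4), (4, 5), (5, 6)],
      [(1, 2), (2, 4), (4, 6), (5, 6)]] (by decide +kernel)
  have h013 := exists_rainbow_of_crosses _ (hcol 0 1 3 (by decide) (by decide) (by decide))
    [[(0, 1), (0, 2), (2, 3)], [(0, 1), (1, 2), (2, 3)], [(0, 2), (1, 2), (2, 3)],
      [(0, 1), (0, 2), (2, 4), (3, 4)], [(0, 1), (1, 2), (2, 4), (3, 4)],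
      [(0, 2), (1, 2), (2, 4), (3, 4)]] (by decide +kernel)
  have h356 := exists_rainbow_of_crosses _ (hcol 3 5 6 (by decide) (by decide) (by decide))
    [[(3, 4), (4, 5), (4, 6)], [(3, 4), (4, 5), (5, 6)], [(3, 4), (4, 6), (5, 6)],
      [(2, 3), (2, 4), (4, 5), (4, 6)], [(2, 3), (2, 4), (4, 5), (5, 6)],
      [(2, 3), (2, 4), (4, 6), (5, 6)]] (by decide +kernel)
  have h035 := exists_rainbow_of_crosses _ (hcol 0 3 5 (by decide) (by decide) (by decide))
    [[(0, 2), (2, 3), (3, 4), (4, 5)], [(0, 2), (2, 3), (2, 4), (4, 5)],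
      [(0, 2), (3, 4), (2, 4), (4, 5)]] (by decide +kernel)
  have h036 := exists_rainbow_of_crosses _ (hcol 0 3 6 (by decide) (by decide) (by decide))
    [[(0, 2), (2, 3), (3, 4), (4, 6)], [(0, 2), (2, 3), (2, 4), (4, 6)],
      [(0, 2), (3, 4), (2, 4), (4, 6)]] (by decide +kernel)
  have h135 := exists_rainbow_of_crosses _ (hcol 1 3 5 (by decide) (by decide) (by decide))
    [[(1, 2), (2, 3), (3, 4), (4, 5)], [(1, 2), (2, 3), (2, 4), (4, 5)],
      [(1, 2), (3, 4), (2, 4), (4, 5)]] (by decide +kernel)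
  have h136 := exists_rainbow_of_crosses _ (hcol 1 3 6 (by decide) (by decide) (by decide))
    [[(1, 2), (2, 3), (3, 4), (4, 6)], [(1, 2), (2, 3), (2, 4), (4, 6)],
      [(1, 2), (3, 4), (2, 4), (4, 6)]] (by decide +kernel)
  have key : ∀ {T : List (List (Fin 7 × Fin 7))}, (∃ t ∈ T, (t.map col).Nodup) →
      SomeNodup (T.map (List.map col)) := by simp [SomeNodup]
  exact not_colorable_F5 _ _ _ _ _ (key h015) _ (key h016) _ (key h056) (key h156) _ _ (key h013)
    (key h356) (key h035) (key h036) (key h135) (key h136)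

/-! ### The lower bound for cycles -/

/-- A cycle with `n` edges, at most six of them marked, is cut by three vertices into arcs with at
most two marked edges each. -/
theorem exists_three_arcs {n : ℕ} (hn : 4 ≤ n) (M : Finset ℕ) (hM : ∀ i ∈ M, i < n)
    (h6 : M.card ≤ 6) : ∃ y z, 0 < y ∧ y < z ∧ z < n ∧ (M.filter fun i => i < y).card ≤ 2 ∧
      (M.filter fun i => y ≤ i ∧ i < z).card ≤ 2 ∧ (M.filter fun i => z ≤ i).card ≤ 2 := by
  let N : ℕ → ℕ := fun v => (M.filter fun i => i < v).card
  have hN0 : N 0 = 0 := by simp [N]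
  have hNn : N n = M.card := by
    simp only [N]
    rw [Finset.filter_true_of_mem hM]
  have hstep : ∀ v, N (v + 1) ≤ N v + 1 := by
    intro v
    calc N (v + 1) ≤ (insert v (M.filter fun i => i < v)).card := by
          refine Finset.card_le_card fun i hi => ?_
          simp only [Finset.mem_filter, Finset.mem_insert] at hi ⊢
          have := hi.1
          grind
      _ ≤ N v + 1 := Finset.card_insert_le _ _
  have hmid : ∀ y z, y ≤ z → N y + (M.filter fun i => y ≤ i ∧ i < z).card = N z := by
    intro y z hyz
    simp only [N]
    rw [← Finset.card_union_of_disjoint]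
    · congr 1
      ext i
      simp only [Finset.mem_union, Finset.mem_filter]
      grind
    · rw [Finset.disjoint_left]
      intro i hi hi'
      simp only [Finset.mem_filter] at hi hi'
      omega
  have hlast : ∀ z, N z + (M.filter fun i => z ≤ i).card = M.card := by
    intro z
    simp only [N]
    rw [← Finset.card_filter_add_card_filter_not (s := M) (fun i => i < z)]
    simp only [not_lt]
  -- the first two arcs are taken as long as possible
  let y := Nat.findGreatest (fun v => N v ≤ 2) (n - 2)
  have h1 := hstep 0
  have h2 := hstep 1
  have hy2 : 2 ≤ y := Nat.le_findGreatest (by omega) (by norm_num at h1 h2 ⊢; omega)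
  have hyn : y ≤ n - 2 := Nat.findGreatest_le _
  have hyN : N y ≤ 2 := Nat.findGreatest_spec (P := fun v => N v ≤ 2) (m := 0) (by omega)
    (by omega)
  have hymax : ∀ v, y < v → v ≤ n - 2 → 2 < N v := fun v hv hvn =>
    not_le.1 (Nat.findGreatest_is_greatest (P := fun v => N v ≤ 2) hv hvn)
  let z := Nat.findGreatest (fun v => N v ≤ N y + 2) (n - 1)
  have h3 := hstep y
  have hzy : y + 1 ≤ z := Nat.le_findGreatest (by omega) (by omega)
  have hzn : z ≤ n - 1 := Nat.findGreatest_le _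
  have hzN : N z ≤ N y + 2 := Nat.findGreatest_spec (P := fun v => N v ≤ N y + 2) (m := y)
    (by omega) (by omega)
  have hzmax : ∀ v, z < v → v ≤ n - 1 → N y + 2 < N v := fun v hv hvn =>
    not_le.1 (Nat.findGreatest_is_greatest (P := fun v => N v ≤ N y + 2) hv hvn)
  have h4 := hmid y z (by omega)
  have h5 := hlast z
  refine ⟨y, z, by omega, by omega, by omega, hyN, by omega, ?_⟩
  have h7 := hstep z
  by_cases hz : z = n - 1
  · rw [show z + 1 = n by omega] at h7
    omega
  · have h8 := hzmax (z + 1) (by omega) (by omega)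
    have h9 := hymax (y + 1) (by omega) (by omega)
    omega

/-- With `n - 3` colours, at most six of `n` edges can be chosen so that a colour is repeated even
after two of them are deleted: three edges are not the chosen representatives of their colours, and
they are taken together with these representatives. -/
theorem exists_repeated_color {n : ℕ} (hn : 4 ≤ n) (col : ℕ → ℕ) (hcol : ∀ i < n, col i < n - 3) :
    ∃ M : Finset ℕ, (∀ i ∈ M, i < n) ∧ M.card ≤ 6 ∧ ∀ A ⊆ M, A.card ≤ 2 →
      ∃ i ∈ M \ A, ∃ j ∈ M \ A, i ≠ j ∧ col i = col j := by
  have hrep : ∀ k, ∃ r, (∃ i < n, col i = k) → r < n ∧ col r = k := by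
    intro k
    by_cases h : ∃ i < n, col i = k
    · obtain ⟨i, hi, hk⟩ := h
      exact ⟨i, fun _ => ⟨hi, hk⟩⟩
    · exact ⟨0, fun h' => absurd h' h⟩
  choose r hr using hrep
  have hr' : ∀ i < n, r (col i) < n ∧ col (r (col i)) = col i := fun i hi => hr _ ⟨i, hi, rfl⟩
  let R : Finset ℕ := (Finset.range (n - 3)).image r
  have hR : R.card ≤ n - 3 := by
    simpa using Finset.card_image_le (s := Finset.range (n - 3)) (f := r)
  have h3 : 3 ≤ (Finset.range n \ R).card := by
    have := Finset.le_card_sdiff R (Finset.range n)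
    rw [Finset.card_range] at this
    omega
  obtain ⟨D, hD, hD3⟩ := Finset.exists_subset_card_eq h3
  have hDn : ∀ i ∈ D, i < n ∧ i ∉ R := fun i hi => by simpa using hD hi
  let Q : Finset ℕ := D.image fun i => r (col i)
  have hQ : Q.card ≤ 3 := hD3 ▸ Finset.card_image_le
  have hdisj : Disjoint D Q := by
    rw [Finset.disjoint_left]
    intro i hi hiQ
    obtain ⟨j, hj, rfl⟩ := Finset.mem_image.1 hiQ
    exact (hDn _ hi).2 (Finset.mem_image_of_mem r (Finset.mem_range.2 (hcol j (hDn j hj).1)))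
  have hcard : (D ∪ Q).card = 3 + Q.card := by rw [Finset.card_union_of_disjoint hdisj, hD3]
  refine ⟨D ∪ Q, ?_, by omega, fun A hA hA2 => ?_⟩
  · intro i hi
    rcases Finset.mem_union.1 hi with hi | hi
    · exact (hDn i hi).1
    · obtain ⟨j, hj, rfl⟩ := Finset.mem_image.1 hi
      exact (hr' j (hDn j hj).1).1
  · refine Finset.exists_ne_map_eq_of_card_lt_of_maps_to (t := Q.image col) ?_ ?_
    · rw [Finset.card_sdiff_of_subset hA]
      have := Finset.card_image_le (s := Q) (f := col)
      omega
    · intro i hi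
      have hi := (Finset.mem_sdiff.1 hi).1
      rcases Finset.mem_union.1 hi with hi | hi
      · exact Finset.mem_image.2 ⟨_, Finset.mem_image_of_mem _ hi, (hr' i (hDn i hi).1).2⟩
      · exact Finset.mem_image_of_mem _ hi

theorem card_le_rx_of_cycle [Finite V] (hn : 4 ≤ Nat.card V) (hG : G.Connected)
    (h : Nonempty (G ≃g cycleGraph (Nat.card V))) : Nat.card V ≤ rx 3 G + 2 := by
  obtain ⟨φ⟩ := h
  obtain ⟨c, hc⟩ := exists_isRainbowColoring_rx 3 G hG
  by_contra! hlt
  generalize Nat.card V = n at *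
  have hmod : ∀ i, i % n < n := fun i => Nat.mod_lt _ (by omega)
  let w : ℕ → V := fun i => φ.symm ⟨i % n, hmod i⟩
  have hφw : ∀ i, (φ (w i)).val = i % n := fun i => by simp [w]
  have hwφ : ∀ v, w (φ v).val = v := fun v => by simp [w, Nat.mod_eq_of_lt]
  have hwmod : ∀ i, w (i % n) = w i := fun i => by simp [w]
  have hwinj : ∀ i j, i < n → j < n → w i = w j → i = j := by
    intro i j hi hj hij
    have := hφw i
    rw [hij, hφw j, Nat.mod_eq_of_lt hi, Nat.mod_eq_of_lt hj] at this
    exact this.symm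
  have hsub : ∀ a b : Fin n, (a - b).val = 1 → a.val = (b.val + 1) % n := by
    intro a b hab
    have ha := a.2
    have hb := b.2
    rw [Fin.val_sub] at hab
    rcases le_or_gt b.val a.val with h | h
    · rw [show n - b.val + a.val = (a.val - b.val) + n by omega, Nat.add_mod_right,
        Nat.mod_eq_of_lt (by omega)] at hab
      rw [Nat.mod_eq_of_lt (by omega)]
      omega
    · rw [Nat.mod_eq_of_lt (by omega)] at hab
      rw [show b.val + 1 = n by omega, Nat.mod_self]
      omega
  have hedge : ∀ u v, G.Adj u v → ∃ k < n, s(u, v) = s(w k, w (k + 1)) := by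
    intro u v huv
    rw [← φ.map_adj_iff, cycleGraph_adj'] at huv
    rcases huv with h | h
    · refine ⟨(φ v).val, (φ v).2, ?_⟩
      rw [← hwmod (_ + 1), ← hsub _ _ h, hwφ, hwφ, Sym2.eq_swap]
    · refine ⟨(φ u).val, (φ u).2, ?_⟩
      rw [← hwmod (_ + 1), ← hsub _ _ h, hwφ, hwφ]
  have hsucc : ∀ i < n, (i + 1) % n = i + 1 ∨ (i + 1 = n ∧ (i + 1) % n = 0) := by
    intro i hi
    rcases (show i + 1 < n ∨ i + 1 = n by omega) with h | h
    · exact Or.inl (Nat.mod_eq_of_lt h)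
    · exact Or.inr ⟨h, by rw [h, Nat.mod_self]⟩
  have hinj : ∀ i j, i < n → j < n → s(w i, w (i + 1)) = s(w j, w (j + 1)) → i = j := by
    intro i j hi hj hij
    rw [← hwmod (i + 1), ← hwmod (j + 1)] at hij
    have h1 := hsucc i hi
    have h2 := hsucc j hj
    rcases Sym2.eq_iff.1 hij with ⟨h3, -⟩ | ⟨h3, h4⟩
    · exact hwinj _ _ hi hj h3
    · have h5 := hwinj _ _ hi (hmod _) h3
      have h6 := hwinj _ _ (hmod _) hj h4
      omega
  classical
  let col : ℕ → ℕ := fun i =>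
    if h : s(w i, w (i + 1)) ∈ G.edgeSet then (c ⟨_, h⟩).val else 0
  obtain ⟨M, hM, hM6, hrep⟩ := exists_repeated_color hn col fun i _ => by
    simp only [col]
    split_ifs with h
    · have := (c ⟨_, h⟩).2
      omega
    · omega
  obtain ⟨y, z, hy, hyz, hz, hA1, hA2, hA3⟩ := exists_three_arcs hn M hM hM6
  obtain ⟨F, hF, hrb, hcut⟩ := hc.exists_edges (x := w 0) (y := w y) (z := w z)
    (fun h => by have := hwinj _ _ (by omega) (by omega) h; omega)
    (fun h => by have := hwinj _ _ (by omega) (by omega) h; omega)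
    (fun h => by have := hwinj _ _ (by omega) (by omega) h; omega)
  -- outside of each of the arcs an edge of the cycle is missing in the tree
  have hmiss : ∀ (p : ℕ → Prop) [DecidablePred p], (M.filter fun i => p i).card ≤ 2 →
      ∃ i < n, ¬ p i ∧ s(w i, w (i + 1)) ∉ F := by
    intro p _ hp
    obtain ⟨i, hi, j, hj, hij, hcij⟩ := hrep _ (Finset.filter_subset p M) hp
    simp only [Finset.mem_sdiff, Finset.mem_filter, not_and] at hi hj
    by_contra! hall
    have hiF := hall i (hM i hi.1) (hi.2 hi.1)
    have hjF := hall j (hM j hj.1) (hj.2 hj.1)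
    simp only [col, dif_pos (hF hiF), dif_pos (hF hjF)] at hcij
    have := hrb ⟨_, hF hiF⟩ ⟨_, hF hjF⟩ hiF hjF (Fin.ext hcij)
    exact hij (hinj i j (hM i hi.1) (hM j hj.1) (congrArg Subtype.val this))
  -- two missing edges in different arcs disconnect the tree
  have hcontra : ∀ i j, i < n → j < n → s(w i, w (i + 1)) ∉ F → s(w j, w (j + 1)) ∉ F →
      ¬ ((i < y ∧ y ≤ j) ∨ (i < z ∧ z ≤ j)) := by
    intro i j hi hj hiF hjF hij
    obtain ⟨u, hu, v, hv, huv⟩ := hcut {v | i < (φ v).val ∧ (φ v).val ≤ j} (by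
      simp only [Set.mem_ofPred_eq, hφw, Nat.mod_eq_of_lt hz, Nat.mod_eq_of_lt (hyz.trans hz),
        Nat.zero_mod]
      omega)
    simp only [Set.mem_ofPred_eq] at hu hv
    obtain ⟨k, hk, hkuv⟩ := hedge u v (hF huv)
    rw [hkuv] at huv
    have h1 := hsucc k hk
    have h2 : k ≠ i := by
      rintro rfl
      exact hiF huv
    have h3 : k ≠ j := by
      rintro rfl
      exact hjF huv
    rcases Sym2.eq_iff.1 hkuv with ⟨rfl, rfl⟩ | ⟨rfl, rfl⟩ <;>
    · simp only [hφw, Nat.mod_eq_of_lt hk] at hu hv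
      omega
  obtain ⟨i, hi, hiA, hiF⟩ := hmiss (fun i => i < y) hA1
  obtain ⟨j, hj, hjA, hjF⟩ := hmiss (fun i => y ≤ i ∧ i < z) hA2
  obtain ⟨k, hk, hkA, hkF⟩ := hmiss (fun i => z ≤ i) hA3
  have := hcontra i j hi hj hiF hjF
  have := hcontra j i hj hi hjF hiF
  have := hcontra i k hi hk hiF hkF
  have := hcontra k i hk hi hkF hiF
  have := hcontra j k hj hk hjF hkF
  have := hcontra k j hk hj hkF hjF
  omega

/-! ### The characterization -/

theorem card_le_rx_of_extremal [Finite V] (hG : G.Connected) (hn : 4 ≤ Nat.card V)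
    (h : IsTwoConnectedExtremal G ∨ IsCutVertexExtremal G) : Nat.card V ≤ rx 3 G + 2 := by
  have hcard : ∀ {m : ℕ}, (V ≃ Fin m) → Nat.card V = m := fun f => by
    rw [Nat.card_congr f, Nat.card_fin]
  have hiso : ∀ {m : ℕ} {H K : SimpleGraph (Fin m)} (f : G ≃g H) (σ : Fin m ≃ Fin m),
      (∀ a b, H.Adj a b → K.Adj (σ a) (σ b)) → IsSpanningSubgraphOf G K := fun f σ h =>
    ⟨f.toEquiv.trans σ, fun u v huv => h _ _ (f.map_adj_iff.2 huv)⟩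
  rcases h with ⟨-, h | h | h | h⟩ | ⟨⟨f⟩⟩ | ⟨⟨f⟩⟩ | ⟨⟨f⟩⟩ | ⟨⟨f⟩⟩ | ⟨⟨f⟩⟩
  · exact card_le_rx_of_cycle hn hG h
  · have := four_le_rx_of_threeSun hG h
    have := hcard h.choose
    omega
  · have := three_le_rx_of_K5MinusEdge hG h
    have := hcard h.choose
    omega
  · have := two_le_rx_of_completeGraph hG h
    have := hcard h.choose
    omega
  · -- vertices of different triangles of `F1` are not adjacent
    have := three_le_rx_of_K5MinusEdge hG (hiso f (Equiv.swap 1 3) (by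
      unfold F1 K5MinusEdge
      simp only [deleteEdges_adj, top_adj, Set.mem_singleton_iff]
      decide))
    have := hcard f.toEquiv
    omega
  · have := four_le_rx_of_F3 hG (hiso f (Equiv.refl _) (by
      unfold F2 F3
      decide))
    have := hcard f.toEquiv
    omega
  · have := four_le_rx_of_F3 hG (hiso f (Equiv.refl _) fun _ _ h => h)
    have := hcard f.toEquiv
    omega
  · have := four_le_rx_of_F4 hG (hiso f (Equiv.refl _) fun _ _ h => h)
    have := hcard f.toEquiv
    omega
  · have := five_le_rx_of_F5 hG (hiso f (Equiv.refl _) fun _ _ h => h)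
    have := hcard f.toEquiv
    omega

end RainbowIndex

theorem theorem8 {V : Type*} [Finite V] (G : SimpleGraph V) (hn : 4 ≤ Nat.card V)
    (hG : G.IsEdgeConnected 2) :
    RainbowIndex.rx 3 G ≤ Nat.card V - 2 ∧
      (RainbowIndex.rx 3 G = Nat.card V - 2 ↔
        RainbowIndex.IsTwoConnectedExtremal G ∨ RainbowIndex.IsCutVertexExtremal G) := by
  have : Nonempty V := (Nat.card_pos_iff.1 (by omega)).1
  have hconn : G.Connected := hG.connected two_ne_zero
  have hup := RainbowIndex.rx_add_two_le hG hconn hn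
  refine ⟨by omega, fun h => ?_, fun h => ?_⟩
  · refine RainbowIndex.extremal_of_not_savesThree hG hconn hn fun h3 => ?_
    unfold RainbowIndex.SavesThree at h3
    omega
  · have := RainbowIndex.card_le_rx_of_extremal hconn hn h
    omega
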